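/- **Proposition (Collins; unitary Weingarten formula).** Let $n,\tau$ be positive integers. *Gram matrix.* For $\sigma\in S_n$ let $u_\sigma$ be the operator on $(\mathbb C^\tau)^{\otimes n}$ that permutes the tensor factors by $\sigma$, i.e. $u_\sigma(e_{b_1}\otimes\cdots\otimes e_{b_n})=e_{b_{\sigma^{-1}(1)}}\otimes\cdots\otimes e_{b_{\sigma^{-1}(n)}}$; these are the invariants of $U(\tau)$ in $\mathrm{End}((\mathbb C^\tau)^{\otimes n})$ indexed by permutations. Let $\mathbf G$ be their Gram matrix, $\mathbf G_{\sigma,\sigma'}=\operatorname{tr}(u_\sigma^{T}u_{\sigma'})$. The Weingarten matrix $\mathbf W$ of $U(\tau)$ is the (Moore–Penrose) pseudo-inverse of $\mathbf G$: the unique matrix with $\mathbf{GWG}=\mathbf G$, $\mathbf{WGW}=\mathbf W$ and with $\mathbf{GW}$, $\mathbf{WG}$ Hermitian. *Idempotents.* In $\mathbb C[S_n]$ let $m_k=\sum_{i<k}(i\;k)$, $1\le k\le n$ (so $m_1=0$), be the Jucys–Murphy elements. For a standard Young tableau $T$ with $n$ boxes let $T_k$ be the box of $T$ labelled $k$, and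 let $c(i,j)=j-i$ be the content of the box in row $i$ and column $j$. Define $$e_T=\prod_{k=1}^{n}\ \prod_{b\ne T_k}\frac{m_k-c(b)}{c(T_k)-c(b)},$$ where, for each $k$, $b$ runs over the boxes other than $T_k$ that can be added to the Young diagram $\{T_1,\dots,T_{k-1}\}$ so that the result is again a Young diagram. For a partition $\lambda\vdash n$ put $$P_\lambda=\sum_{T\text{ standard of shape }\lambda}e_T,\qquad c_\lambda=\prod_{(i,j)\in\lambda}(\tau+j-i),\qquad W=\sum_{\lambda\vdash n,\ c_\lambda\neq0}c_\lambda^{-1}P_\lambda\in\mathbb C[S_n].$$ Then: 1. $(e_T)_T$ is the family of Young's orthogonal idempotents, that is, the unique family in $\mathbb C[S_n]$, indexed by all standard Young tableaux with $n$ boxes, such that $e_Te_{T'}=\delta_{TT'}e_T$, $\sum_Te_T=1$ and $m_ke_T=e_Tm_k=c(T_k)\,e_T$ for all $k$ and $T$. 2. $\mathbf G_{\sigma,\sigma'}=\tau^{\#\mathrm{cycles}(\sigma^{-1}\sigma')}$ for all $\sigma,\sigma'\in S_n$, where fixed points count as cycles. 3. The Weingarten matrix $\mathbf W$ is the matrix,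 in the basis $S_n$, of left multiplication by $W$ on $\mathbb C[S_n]$, and also that of right multiplication by $W$ (the left and the right regular representation). It is symmetric. -/

import Mathlib

open scoped Matrix

noncomputable section

namespace UnitaryWeingarten

/-! ### The group algebra of the symmetric group and the Jucys-Murphy elements -/

/-- The group algebra `ℂ[S_n]`; the permuted letters are `0, …, n - 1`. -/
abbrev GroupAlg (n : ℕ) : Type := MonoidAlgebra ℂ (Equiv.Perm (Fin n))

/-- The Jucys-Murphy element of the letter `k`: the sum of the transpositions `(i k)` over all
letters `i < k`. In particular it is `0` for the first letter. -/
def jucysMurphy {n : ℕ} (k : Fin n) : GroupAlg n :=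
  ∑ i ∈ Finset.univ.filter (fun i : Fin n => i < k), MonoidAlgebra.single (Equiv.swap i k) (1 : ℂ)

/-! ### Partitions of `n` and standard Young tableaux -/

/-- The partitions `λ ⊢ n`, represented by their Young diagrams. -/
abbrev Shape (n : ℕ) : Type := {μ : YoungDiagram // μ.card = n}

lemma mem_box_of_mem {μ : YoungDiagram} {b : ℕ × ℕ} (hb : b ∈ μ) :
    b ∈ Finset.range μ.card ×ˢ Finset.range μ.card := by
  obtain ⟨i, j⟩ := b
  rw [Finset.mem_product, Finset.mem_range, Finset.mem_range]
  constructor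
  · have h : ((Finset.range (i + 1)).image fun a => (a, j)) ⊆ μ.cells := by
      intro c hc
      obtain ⟨a, ha, rfl⟩ := Finset.mem_image.1 hc
      exact μ.up_left_mem (Nat.lt_succ_iff.1 (Finset.mem_range.1 ha)) le_rfl hb
    have h' := Finset.card_le_card h
    rw [Finset.card_image_of_injective _ (fun a a' e => (Prod.ext_iff.1 e).1),
      Finset.card_range] at h'
    exact h'
  · have h : ((Finset.range (j + 1)).image fun a => (i, a)) ⊆ μ.cells := by
      intro c hc
      obtain ⟨a, ha, rfl⟩ := Finset.mem_image.1 hc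
      exact μ.up_left_mem le_rfl (Nat.lt_succ_iff.1 (Finset.mem_range.1 ha)) hb
    have h' := Finset.card_le_card h
    rw [Finset.card_image_of_injective _ (fun a a' e => (Prod.ext_iff.1 e).2),
      Finset.card_range] at h'
    exact h'

instance (n : ℕ) : Fintype (Shape n) :=
  Fintype.ofInjective
    (fun μ : Shape n =>
      (⟨μ.1.cells, Finset.mem_powerset.2 fun b hb => by
        have h := mem_box_of_mem (μ := μ.1) hb
        rwa [μ.2] at h⟩ : (Finset.range n ×ˢ Finset.range n).powerset))
    (fun _ _ h => Subtype.ext (YoungDiagram.ext (congrArg Subtype.val h)))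

/-- The content `j - i` of the box in row `i` and column `j`. -/
def content (b : ℕ × ℕ) : ℂ := (b.2 : ℂ) - (b.1 : ℂ)

/-- A standard Young tableau with `n` boxes, of shape `μ`: a filling of the boxes of `μ` with the
labels `0, …, n - 1`, each used once, increasing along rows and along columns. -/
@[ext]
structure StandardTableau (n : ℕ) (μ : YoungDiagram) where
  entry : {b : ℕ × ℕ // b ∈ μ} ≃ Fin n
  row_lt : ∀ a b : {b : ℕ × ℕ // b ∈ μ}, a.1.1 = b.1.1 → a.1.2 < b.1.2 → entry a < entry b
  col_lt : ∀ a b : {b : ℕ × ℕ // b ∈ μ}, a.1.2 = b.1.2 → a.1.1 < b.1.1 → entry a < entry b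

open Classical in
instance (n : ℕ) (μ : YoungDiagram) : Fintype (StandardTableau n μ) :=
  haveI : Fintype {b : ℕ × ℕ // b ∈ μ} := Finset.Subtype.fintype μ.cells
  Fintype.ofInjective StandardTableau.entry (fun _ _ h => StandardTableau.ext h)

/-- The set of all standard Young tableaux with `n` boxes, of arbitrary shape `λ ⊢ n`. -/
abbrev Tableau (n : ℕ) : Type := Σ μ : Shape n, StandardTableau n μ.1

namespace StandardTableau

variable {n : ℕ} {μ : YoungDiagram}

/-- The box of `T` that carries the label `k`. -/
def box (T : StandardTableau n μ) (k : Fin n) : ℕ × ℕ := (T.entry.symm k).1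

lemma entry_mono (T : StandardTableau n μ) {a b : ℕ × ℕ} (hab : a ≤ b) (ha : a ∈ μ) (hb : b ∈ μ) :
    T.entry ⟨a, ha⟩ ≤ T.entry ⟨b, hb⟩ := by
  obtain ⟨i, j⟩ := a
  obtain ⟨i', j'⟩ := b
  obtain ⟨hi, hj⟩ := Prod.mk_le_mk.1 hab
  have hc : (i, j') ∈ μ := μ.up_left_mem hi le_rfl hb
  have h1 : T.entry ⟨(i, j), ha⟩ ≤ T.entry ⟨(i, j'), hc⟩ := by
    rcases hj.eq_or_lt with rfl | hj
    · exact le_rfl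
    · exact (T.row_lt ⟨(i, j), ha⟩ ⟨(i, j'), hc⟩ rfl hj).le
  have h2 : T.entry ⟨(i, j'), hc⟩ ≤ T.entry ⟨(i', j'), hb⟩ := by
    rcases hi.eq_or_lt with rfl | hi
    · exact le_rfl
    · exact (T.col_lt ⟨(i, j'), hc⟩ ⟨(i', j'), hb⟩ rfl hi).le
  exact h1.trans h2

/-- The shape formed by the boxes of `T` whose label is smaller than `k`. -/
def shapeBelow (T : StandardTableau n μ) (k : Fin n) : YoungDiagram where
  cells := (Finset.univ.filter (fun i : Fin n => i < k)).image T.box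
  isLowerSet := by
    intro b a hab hb
    simp only [Finset.coe_image, Set.mem_image, Finset.mem_coe, Finset.mem_filter,
      Finset.mem_univ, true_and] at hb ⊢
    obtain ⟨i, hi, rfl⟩ := hb
    have hb : T.box i ∈ μ := (T.entry.symm i).2
    have ha : a ∈ μ := μ.isLowerSet hab hb
    refine ⟨T.entry ⟨a, ha⟩, lt_of_le_of_lt ((T.entry_mono hab ha hb).trans ?_) hi, ?_⟩
    · simp [box]
    · simp [box]

end StandardTableau

/-- The boxes that can be added to a Young diagram so that the result is again a Young diagram
(such a box lies in the square of side `ν.card + 1`). -/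
def addable (ν : YoungDiagram) : Finset (ℕ × ℕ) :=
  haveI := Classical.decPred fun b : ℕ × ℕ =>
    b ∉ ν ∧ IsLowerSet (insert b (ν : Set (ℕ × ℕ)))
  (Finset.range (ν.card + 1) ×ˢ Finset.range (ν.card + 1)).filter
    fun b => b ∉ ν ∧ IsLowerSet (insert b (ν : Set (ℕ × ℕ)))

/-! ### Young's orthogonal idempotents -/

/-- The factor `∏ (m_k - c(T'_k)) / (c(T_k) - c(T'_k))`, where `T'_k` runs over the boxes other than
`T_k` which can be added to the subtableau of `T` formed by the labels smaller than `k`. -/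
def interpolationFactor {n : ℕ} {μ : YoungDiagram} (T : StandardTableau n μ) (k : Fin n) :
    GroupAlg n :=
  Polynomial.aeval (jucysMurphy k)
    (∏ b ∈ (addable (T.shapeBelow k)).erase (T.box k),
      Polynomial.C (content (T.box k) - content b)⁻¹ * (Polynomial.X - Polynomial.C (content b)))

/-- Young's orthogonal idempotent `e_T`, by Lagrange interpolation in the Jucys-Murphy elements:
the idempotent of the tableau with its last box removed is multiplied by the factor of the last
box. -/
def youngIdempotent {n : ℕ} {μ : YoungDiagram} (T : StandardTableau n μ) : GroupAlg n :=
  (List.ofFn fun k : Fin n => interpolationFactor T k).prod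

open Classical in
/-- The characterization of Young's orthogonal idempotents: they form a complete set of orthogonal
idempotents, indexed by all standard tableaux with `n` boxes, and they diagonalize the
Jucys-Murphy elements, with the contents of the tableaux as eigenvalues. -/
structure IsYoungOrthogonal {n : ℕ} (e : Tableau n → GroupAlg n) : Prop where
  mul_eq : ∀ T T', e T * e T' = if T = T' then e T else 0
  sum_eq : ∑ T, e T = 1
  jucysMurphy_mul : ∀ k T, jucysMurphy k * e T = content (T.2.box k) • e T
  mul_jucysMurphy : ∀ k T, e T * jucysMurphy k = content (T.2.box k) • e T

/-- The central idempotent `P_λ = ∑ e_T`, summed over the standard tableaux of shape `λ`. -/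
def centralIdempotent {n : ℕ} (μ : Shape n) : GroupAlg n :=
  ∑ T : StandardTableau n μ.1, youngIdempotent T

/-- `c_λ = ∏_{(i,j) ∈ λ} (τ + j - i)`. -/
def contentProduct (τ : ℕ) (μ : YoungDiagram) : ℂ := ∏ b ∈ μ.cells, ((τ : ℂ) + content b)

open Classical in
/-- `W = ∑ c_λ⁻¹ P_λ`, summed over the partitions `λ ⊢ n` with `c_λ ≠ 0`. -/
def weingartenElement (n τ : ℕ) : GroupAlg n :=
  ∑ μ ∈ Finset.univ.filter (fun μ : Shape n => contentProduct τ μ.1 ≠ 0),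
    (contentProduct τ μ.1)⁻¹ • centralIdempotent μ

/-! ### The Gram matrix and its pseudo-inverse -/

/-- The matrix, in the standard basis of `(ℂ^τ)^{⊗n}`, of the operator which permutes the tensor
factors by `σ`, that is, of `e_b ↦ e_{b ∘ σ⁻¹}`. These are the invariants of `U(τ)` in
`End((ℂ^τ)^{⊗n})` which are indexed by permutations. -/
def permOperator (τ : ℕ) {n : ℕ} (σ : Equiv.Perm (Fin n)) :
    Matrix (Fin n → Fin τ) (Fin n → Fin τ) ℂ :=
  Matrix.of fun a b => if a = b ∘ ⇑σ⁻¹ then 1 else 0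

/-- The Gram matrix of the operators `permOperator τ σ` for the symmetric non-degenerate bilinear
form `(A, B) ↦ tr (Aᵀ B)`, the sum of the products of matching entries. -/
def gramMatrix (n τ : ℕ) : Matrix (Equiv.Perm (Fin n)) (Equiv.Perm (Fin n)) ℂ :=
  Matrix.of fun σ σ' => ((permOperator τ σ)ᵀ * permOperator τ σ').trace

/-- The number of cycles of a permutation, fixed points included. -/
def numCycles {n : ℕ} (σ : Equiv.Perm (Fin n)) : ℕ :=
  Nat.card (Quotient (Equiv.Perm.SameCycle.setoid σ))

/-- `W` is the (Moore-Penrose) pseudo-inverse of the square complex matrix `G`. -/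
structure IsPseudoInverse {ι : Type*} [Fintype ι] (G W : Matrix ι ι ℂ) : Prop where
  mul_mul_self : G * W * G = G
  self_mul_mul : W * G * W = W
  isHermitian_mul : (G * W).IsHermitian
  isHermitian_mul' : (W * G).IsHermitian

/-- The matrix of `x ∈ ℂ[S_n]` in the left regular representation, in the basis `S_n`. -/
def leftRegularMatrix {n : ℕ} (x : GroupAlg n) :
    Matrix (Equiv.Perm (Fin n)) (Equiv.Perm (Fin n)) ℂ :=
  LinearMap.toMatrix (MonoidAlgebra.basis (Equiv.Perm (Fin n)) ℂ)
    (MonoidAlgebra.basis (Equiv.Perm (Fin n)) ℂ) (LinearMap.mulLeft ℂ x)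

/-- The matrix of `x ∈ ℂ[S_n]` in the right regular representation, in the basis `S_n`. -/
def rightRegularMatrix {n : ℕ} (x : GroupAlg n) :
    Matrix (Equiv.Perm (Fin n)) (Equiv.Perm (Fin n)) ℂ :=
  LinearMap.toMatrix (MonoidAlgebra.basis (Equiv.Perm (Fin n)) ℂ)
    (MonoidAlgebra.basis (Equiv.Perm (Fin n)) ℂ) (LinearMap.mulRight ℂ x)

end UnitaryWeingarten

end

/-! The proof follows the Okounkov–Vershik analysis of the Jucys–Murphy elements. These commute and
act by symmetric operators on the regular representation, so their joint eigenvectors span it. The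
relation `swap_mul_jucysMurphy` between neighbouring elements constrains the joint eigenvalues
(`isContentSystem_jointSpectrum`), and a combinatorial argument (`IsContentSystem.exists_tableau`)
shows that each eigenvalue sequence is the content vector of a standard tableau. Only this inclusion
is needed, not that every tableau occurs.

Hence an element of the group algebra is determined by its products with eigenvectors belonging to
tableaux (`eq_of_forall_tableau`). There `e_T`, being a Lagrange interpolation at the distinct
contents of addable boxes, acts by 0 or 1, and all defining relations of Young's idempotents can be
checked. They are unique because content vectors separate tableaux.

The Gram entries count colourings of the letters invariant under `σ⁻¹σ'`. So the Gram matrix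
represents, on either side, multiplication by the class function `∑ τ ^ #cycles(σ) σ`. Jucys'
factorization of this element into the factors `τ + m_k` (`gramElement_succ`) gives it the
eigenvalue `c_λ` on `e_T`. Since `W` inverts the nonzero eigenvalues, the Penrose identities become
identities of scalars. Symmetry and Hermitianness hold because inversion of permutations and complex
conjugation fix each `e_T`, again by uniqueness. -/

noncomputable section

namespace UnitaryWeingarten

/-! ### Commutation relations of the Jucys–Murphy elements. -/

section JucysMurphy

variable {n : ℕ}

lemma single_mul_jucysMurphy (σ : Equiv.Perm (Fin n)) {k : Fin n} :
    MonoidAlgebra.single σ (1 : ℂ) * jucysMurphy k =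
      ∑ i ∈ Finset.univ.filter (fun i : Fin n => i < k),
        MonoidAlgebra.single (Equiv.swap (σ i) (σ k) * σ) (1 : ℂ) := by
  rw [jucysMurphy, Finset.mul_sum]
  refine Finset.sum_congr rfl fun i _ => ?_
  rw [MonoidAlgebra.single_mul_single, mul_one, Equiv.mul_swap_eq_swap_mul]

/-- Conjugation by `σ` only permutes the summands `(i k)`. -/
lemma single_commute_jucysMurphy {σ : Equiv.Perm (Fin n)} {k : Fin n} (hk : σ k = k)
    (hσ : ∀ i, σ i < k ↔ i < k) : Commute (MonoidAlgebra.single σ (1 : ℂ)) (jucysMurphy k) := by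
  rw [Commute, SemiconjBy, single_mul_jucysMurphy, jucysMurphy, Finset.sum_mul, hk]
  refine Finset.sum_equiv σ (fun i => ?_) fun i _ => ?_
  · simp [hσ]
  · rw [MonoidAlgebra.single_mul_single, mul_one]

lemma swap_commute_jucysMurphy_of_lt {i j k : Fin n} (hi : i < k) (hj : j < k) :
    Commute (MonoidAlgebra.single (Equiv.swap i j) (1 : ℂ)) (jucysMurphy k) := by
  refine single_commute_jucysMurphy (Equiv.swap_apply_of_ne_of_ne hi.ne' hj.ne') fun l => ?_
  rw [Equiv.swap_apply_def]
  split_ifs with h h' <;> simp_all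

lemma swap_commute_jucysMurphy_of_gt {i j k : Fin n} (hi : k < i) (hj : k < j) :
    Commute (MonoidAlgebra.single (Equiv.swap i j) (1 : ℂ)) (jucysMurphy k) := by
  refine single_commute_jucysMurphy (Equiv.swap_apply_of_ne_of_ne hi.ne hj.ne) fun l => ?_
  rw [Equiv.swap_apply_def]
  split_ifs with h h'
  · subst h; simp [hi.not_gt, hj.not_gt]
  · subst h'; simp [hi.not_gt, hj.not_gt]
  · rfl

lemma jucysMurphy_commute (j k : Fin n) : Commute (jucysMurphy j) (jucysMurphy k) := by
  have key : ∀ j k : Fin n, j < k → Commute (jucysMurphy j) (jucysMurphy k) := fun j k h => by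
    rw [jucysMurphy]
    refine Commute.sum_left _ _ _ fun i hi => ?_
    exact swap_commute_jucysMurphy_of_lt ((Finset.mem_filter.1 hi).2.trans h) h
  rcases lt_trichotomy j k with h | rfl | h
  · exact key j k h
  · exact Commute.refl _
  · exact (key k j h).symm

/-- The relation of the degenerate affine Hecke algebra. -/
lemma swap_mul_jucysMurphy {i j : Fin n} (h : (j : ℕ) = i + 1) :
    MonoidAlgebra.single (Equiv.swap i j) (1 : ℂ) * jucysMurphy i + 1 =
      jucysMurphy j * MonoidAlgebra.single (Equiv.swap i j) (1 : ℂ) := by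
  have hij : i < j := Fin.lt_def.2 (by omega)
  have hf : Finset.univ.filter (fun l : Fin n => l < j) =
      insert i (Finset.univ.filter (fun l : Fin n => l < i)) := by
    ext l
    simp only [Finset.mem_filter, Finset.mem_univ, true_and, Finset.mem_insert, Fin.lt_def,
      Fin.ext_iff]
    omega
  rw [single_mul_jucysMurphy, jucysMurphy, hf, Finset.sum_insert (by simp), add_mul,
    MonoidAlgebra.single_mul_single, Equiv.swap_mul_self, mul_one, ← MonoidAlgebra.one_def,
    add_comm, Finset.sum_mul]
  congr 1
  refine Finset.sum_congr rfl fun l hl => ?_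
  have hl : l < i := (Finset.mem_filter.1 hl).2
  rw [MonoidAlgebra.single_mul_single, mul_one, Equiv.swap_apply_left,
    Equiv.swap_apply_of_ne_of_ne hl.ne (hl.trans hij).ne]

end JucysMurphy

/-! ### Combinatorics of the eigenvalue sequences. -/

section Spectrum

/-- The combinatorial properties of the joint spectrum of the Jucys-Murphy elements from which it
follows that it consists of content vectors. -/
structure IsContentSystem (n : ℕ) (S : Set (ℕ → ℂ)) : Prop where
  zero : ∀ a ∈ S, 0 < n → a 0 = 0
  ne : ∀ a ∈ S, ∀ i, i + 1 < n → a i ≠ a (i + 1)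
  swap : ∀ a ∈ S, ∀ i, i + 1 < n → a (i + 1) ≠ a i + 1 → a (i + 1) ≠ a i - 1 →
    a ∘ Equiv.swap i (i + 1) ∈ S
  not_add : ∀ a ∈ S, ∀ i, i + 2 < n → a (i + 1) = a i + 1 → a (i + 2) ≠ a i
  not_sub : ∀ a ∈ S, ∀ i, i + 2 < n → a (i + 1) = a i - 1 → a (i + 2) ≠ a i

variable {n : ℕ} {S : Set (ℕ → ℂ)}

namespace IsContentSystem

/-- Move the value `a j` to the left by admissible swaps. If no neighbour differing by 1 ever blocks
it, it can be swapped into position 0; then it is 0, equal to the first entry that it passed, which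
`ne` forbids. -/
lemma exists_adjacent (hS : IsContentSystem n S) {j : ℕ} (hj : 0 < j) (hjn : j < n) {a : ℕ → ℂ}
    (ha : a ∈ S) : ∃ i < j, a i = a j + 1 ∨ a i = a j - 1 := by
  induction j generalizing a with
  | zero => omega
  | succ j ih =>
    by_cases h1 : a (j + 1) = a j + 1
    · exact ⟨j, by omega, Or.inr (by rw [h1]; ring)⟩
    by_cases h2 : a (j + 1) = a j - 1
    · exact ⟨j, by omega, Or.inl (by rw [h2]; ring)⟩
    have hs := hS.swap a ha j hjn h1 h2
    rcases Nat.eq_zero_or_pos j with rfl | hj0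
    · have h := hS.zero _ hs (by omega)
      simp only [Function.comp_apply, Equiv.swap_apply_left] at h
      exact absurd ((hS.zero a ha (by omega)).trans h.symm) (hS.ne a ha 0 hjn)
    · obtain ⟨i, hi, h⟩ := ih hj0 (by omega) hs
      refine ⟨i, by omega, ?_⟩
      simpa [Equiv.swap_apply_of_ne_of_ne (show i ≠ j by omega) (show i ≠ j + 1 by omega)] using h

/-- Two equal entries are moved towards each other by admissible swaps, with induction on a bound
`d` for their distance. Once both ends are blocked, their inner neighbours differ from them by 1;
opposite signs give the two entries sought, equal signs are impossible. -/
lemma exists_adjacent_between (hS : IsContentSystem n S) (d : ℕ) :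
    ∀ {a : ℕ → ℂ}, a ∈ S → ∀ {p q : ℕ}, p < q → q < n → q ≤ p + d → a p = a q →
      (∃ r, p < r ∧ r < q ∧ a r = a q + 1) ∧ ∃ r, p < r ∧ r < q ∧ a r = a q - 1 := by
  induction d with
  | zero => intros; omega
  | succ d ih =>
    intro a ha p q hpq hqn hd hap
    by_cases hx : ∃ r, p < r ∧ r < q ∧ a r = a q
    · obtain ⟨r, hpr, hrq, hr⟩ := hx
      obtain ⟨⟨s, hs⟩, ⟨s', hs'⟩⟩ := ih ha hrq hqn (by omega) hr
      exact ⟨⟨s, by omega, by omega, hs.2.2⟩, ⟨s', by omega, by omega, hs'.2.2⟩⟩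
    obtain ⟨q, rfl⟩ : ∃ q', q = q' + 1 := ⟨q - 1, by omega⟩
    have hpq' : p < q := by
      rcases (Nat.lt_succ_iff.1 hpq).eq_or_lt with rfl | h
      · exact absurd hap (hS.ne a ha _ hqn)
      · exact h
    have hcases : ∀ x y : ℂ, x ≠ y + 1 → x ≠ y - 1 → y ≠ x + 1 ∧ y ≠ x - 1 := fun x y h1 h2 =>
      ⟨fun h => h2 (by rw [h]; ring), fun h => h1 (by rw [h]; ring)⟩
    by_cases hq : a q = a (q + 1) + 1 ∨ a q = a (q + 1) - 1
    swap
    · push Not at hq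
      obtain ⟨h1, h2⟩ := hcases _ _ hq.1 hq.2
      have hs := hS.swap a ha q hqn h1 h2
      obtain ⟨⟨r, hr⟩, ⟨r', hr'⟩⟩ := ih hs hpq' (by omega) (by omega) (by
        simp [Equiv.swap_apply_of_ne_of_ne (show p ≠ q by omega) (show p ≠ q + 1 by omega), hap])
      simp only [Function.comp_apply, Equiv.swap_apply_left,
        Equiv.swap_apply_of_ne_of_ne (show r ≠ q by omega) (show r ≠ q + 1 by omega),
        Equiv.swap_apply_of_ne_of_ne (show r' ≠ q by omega) (show r' ≠ q + 1 by omega)] at hr hr'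
      exact ⟨⟨r, by omega, by omega, hr.2.2⟩, ⟨r', by omega, by omega, hr'.2.2⟩⟩
    by_cases hp : a (p + 1) = a p + 1 ∨ a (p + 1) = a p - 1
    swap
    · push Not at hp
      have hs := hS.swap a ha p (by omega) hp.1 hp.2
      have hq1 : q + 1 ≠ p + 1 := by omega
      obtain ⟨⟨r, hr⟩, ⟨r', hr'⟩⟩ := ih hs (p := p + 1) (q := q + 1) (by omega) (by omega)
        (by omega) (by
        simp [Equiv.swap_apply_of_ne_of_ne (show q + 1 ≠ p by omega) hq1, hap])
      simp only [Function.comp_apply,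
        Equiv.swap_apply_of_ne_of_ne (show q + 1 ≠ p by omega) hq1,
        Equiv.swap_apply_of_ne_of_ne (show r ≠ p by omega) (show r ≠ p + 1 by omega),
        Equiv.swap_apply_of_ne_of_ne (show r' ≠ p by omega) (show r' ≠ p + 1 by omega)] at hr hr'
      exact ⟨⟨r, by omega, by omega, hr.2.2⟩, ⟨r', by omega, by omega, hr'.2.2⟩⟩
    rw [hap] at hp
    by_cases hpq1 : p + 1 = q
    · subst hpq1
      rcases hp with h | h
      · exact absurd hap.symm (hS.not_add a ha p hqn (by rw [h, hap]))
      · exact absurd hap.symm (hS.not_sub a ha p hqn (by rw [h, hap]))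
    -- If the inner neighbours agree, they form a shorter pair of equal entries. By induction both
    -- values differing from theirs by 1 lie between them, and one is the value at the ends,
    -- contrary to `hx`.
    by_cases heq : a (p + 1) = a q
    · obtain ⟨⟨r, hr⟩, ⟨r', hr'⟩⟩ := ih ha (p := p + 1) (q := q) (by omega) (by omega)
        (by omega) heq
      exfalso
      rcases hq with h | h
      · exact hx ⟨r', by omega, by omega, by rw [hr'.2.2, h]; ring⟩
      · exact hx ⟨r, by omega, by omega, by rw [hr.2.2, h]; ring⟩
    · rcases hp with h | h <;> rcases hq with h' | h'
      · exact absurd (h.trans h'.symm) heq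
      · exact ⟨⟨p + 1, by omega, by omega, h⟩, ⟨q, by omega, by omega, h'⟩⟩
      · exact ⟨⟨q, by omega, by omega, h'⟩, ⟨p + 1, by omega, by omega, h⟩⟩
      · exact absurd (h.trans h'.symm) heq

end IsContentSystem

end Spectrum

/-! ### Building tableaux from eigenvalue sequences; addable boxes and their contents. -/

section Tableaux

variable {n : ℕ} {μ : YoungDiagram}

/-- The boxes `f 0, …, f (m - 1)` are distinct, have the contents `a 0, …, a (m - 1)`, and each of
them is preceded by all boxes to the north-west of it. -/
structure IsGrowth (a : ℕ → ℂ) (m : ℕ) (f : ℕ → ℕ × ℕ) : Prop where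
  inj : ∀ i < m, ∀ j < m, f i = f j → i = j
  lower : ∀ p < m, ∀ x ≤ f p, ∃ q ≤ p, f q = x
  content_eq : ∀ i < m, content (f i) = a i

/-- Only the boxes directly above and directly left of `b` have to be present: any other box
north-west of `b` is north-west of one of these. -/
lemma IsGrowth.extend {a : ℕ → ℂ} {m : ℕ} {f : ℕ → ℕ × ℕ} (hf : IsGrowth a m f) {b : ℕ × ℕ}
    (hb : ∀ i < m, f i ≠ b) (hrow : ∀ r, b.1 = r + 1 → ∃ i < m, f i = (r, b.2))
    (hcol : ∀ c, b.2 = c + 1 → ∃ i < m, f i = (b.1, c)) (hc : content b = a m) :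
    IsGrowth a (m + 1) (Function.update f m b) := by
  have hu : ∀ i < m, Function.update f m b i = f i := fun i hi =>
    Function.update_of_ne hi.ne _ _
  have hm : Function.update f m b m = b := Function.update_self _ _ _
  refine ⟨fun i hi j hj h => ?_, fun p hp x hx => ?_, fun i hi => ?_⟩
  · rcases (Nat.lt_succ_iff.1 hi).eq_or_lt with rfl | hi <;>
      rcases (Nat.lt_succ_iff.1 hj).eq_or_lt with rfl | hj
    · rfl
    · rw [hm, hu _ hj] at h
      exact absurd h.symm (hb _ hj)
    · rw [hm, hu _ hi] at h
      exact absurd h (hb _ hi)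
    · rw [hu _ hi, hu _ hj] at h
      exact hf.inj i hi j hj h
  · rcases (Nat.lt_succ_iff.1 hp).eq_or_lt with rfl | hp
    · rw [hm] at hx
      obtain ⟨x1, x2⟩ := x
      obtain ⟨b1, b2⟩ := b
      obtain ⟨h1, h2⟩ := Prod.mk_le_mk.1 hx
      have key : ∀ i < p, (x1, x2) ≤ f i →
          ∃ q ≤ p, Function.update f p (b1, b2) q = (x1, x2) := fun i hi hxi => by
        obtain ⟨q, hq, h⟩ := hf.lower i hi _ hxi
        exact ⟨q, by omega, by rw [hu q (by omega), h]⟩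
      rcases h1.eq_or_lt with rfl | h1
      · rcases h2.eq_or_lt with rfl | h2
        · exact ⟨p, le_rfl, hm⟩
        · obtain ⟨c, rfl⟩ : ∃ c, b2 = c + 1 := ⟨b2 - 1, by omega⟩
          obtain ⟨i, hi, h⟩ := hcol c rfl
          exact key i hi (h ▸ Prod.mk_le_mk.2 ⟨le_rfl, by omega⟩)
      · obtain ⟨r, rfl⟩ : ∃ r, b1 = r + 1 := ⟨b1 - 1, by omega⟩
        obtain ⟨i, hi, h⟩ := hrow r rfl
        exact key i hi (h ▸ Prod.mk_le_mk.2 ⟨by omega, h2⟩)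
    · rw [hu _ hp] at hx
      obtain ⟨q, hq, h⟩ := hf.lower p hp x hx
      exact ⟨q, hq, by rw [hu q (by omega), h]⟩
  · rcases (Nat.lt_succ_iff.1 hi).eq_or_lt with rfl | hi
    · rw [hm, hc]
    · rw [hu _ hi, hf.content_eq i hi]

lemma content_eq_add_one {b b' : ℕ × ℕ} (h : content b = content b' + 1) :
    b.2 + b'.1 = b'.2 + 1 + b.1 := by
  unfold content at h
  have : (b.2 : ℂ) + b'.1 = b'.2 + 1 + b.1 := by linear_combination h
  exact_mod_cast this

lemma content_eq {b b' : ℕ × ℕ} (h : content b = content b') : b.2 + b'.1 = b'.2 + b.1 := by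
  unfold content at h
  have : (b.2 : ℂ) + b'.1 = b'.2 + b.1 := by linear_combination h
  exact_mod_cast this

/-- If the content `a m` has already occurred, the new box is the diagonal successor of the last box
with that content. Otherwise it starts a new diagonal, at the end of the first column or the first
row, next to a box given by `exists_adjacent`. -/
lemma IsContentSystem.exists_extend {S : Set (ℕ → ℂ)} (hS : IsContentSystem n S) {a : ℕ → ℂ}
    (ha : a ∈ S) {m : ℕ} (hm : m < n) {f : ℕ → ℕ × ℕ} (hf : IsGrowth a m f) :
    ∃ b, IsGrowth a (m + 1) (Function.update f m b) := by
  rcases Nat.eq_zero_or_pos m with rfl | hm0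
  · refine ⟨(0, 0), hf.extend (by simp) (by simp) (by simp) ?_⟩
    rw [hS.zero a ha hm]
    simp [content]
  have hmem : ∀ i < m, ∀ x ≤ f i, ∃ q < m, f q = x := fun i hi x hx => by
    obtain ⟨q, hq, h⟩ := hf.lower i hi x hx
    exact ⟨q, by omega, h⟩
  by_cases hp : ∃ p < m, a p = a m
  · obtain ⟨p, ⟨hpm, hpa⟩, hmax⟩ : ∃ p, (p < m ∧ a p = a m) ∧ ∀ q < m, a q = a m → q ≤ p := by
      classical
      have hne : ((Finset.range m).filter fun p => a p = a m).Nonempty := by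
        obtain ⟨p, hp⟩ := hp
        exact ⟨p, by simpa using hp⟩
      obtain ⟨p, hp, hmax⟩ := Finset.exists_max_image _ id hne
      exact ⟨p, by simpa using hp, fun q hq h => hmax q (by simpa using ⟨hq, h⟩)⟩
    obtain ⟨⟨s, hps, hsm, hs⟩, ⟨t, hpt, htm, ht⟩⟩ :=
      hS.exists_adjacent_between m ha hpm hm (by omega) hpa
    -- All boxes north-west of `f p` are placed by time `p`. So `f s` and `f t`, which lie on the
    -- two neighbouring diagonals and come later, are weakly south-east of the boxes directly above
    -- and directly left of the new one.
    have hnle : ∀ i, p < i → i < m → ¬ f i ≤ f p := fun i hpi him hle => by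
      obtain ⟨q, hq, h⟩ := hf.lower p hpm _ hle
      have := hf.inj q (by omega) i him h
      omega
    have hs' := hnle s hps hsm
    have ht' := hnle t hpt htm
    rw [← hf.content_eq s hsm, ← hpa, ← hf.content_eq p hpm] at hs
    rw [← hf.content_eq t htm, ← hpa, ← hf.content_eq p hpm] at ht
    have hs := content_eq_add_one hs
    have ht := content_eq_add_one (show content (f p) = content (f t) + 1 by rw [ht]; ring)
    rw [Prod.le_def] at hs' ht'
    refine ⟨((f p).1 + 1, (f p).2 + 1), hf.extend (fun i hi h => ?_) (fun r hr => ?_)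
      (fun c hc => ?_) ?_⟩
    · have hai : a i = a m := by
        rw [← hf.content_eq i hi, ← hpa, ← hf.content_eq p hpm, h]
        simp [content]
      have hip := hmax i hi hai
      obtain ⟨q, hq, h'⟩ := hf.lower i hi (f p) (by rw [h, Prod.le_def]; simp)
      have hqp := hf.inj q (by omega) p hpm h'
      obtain rfl : i = p := by omega
      have := congrArg Prod.fst h
      simp at this
    · refine hmem s hsm _ (Prod.le_def.2 ⟨?_, ?_⟩) <;> simp only at hr ⊢ <;> omega
    · refine hmem t htm _ (Prod.le_def.2 ⟨?_, ?_⟩) <;> simp only at hc ⊢ <;> omega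
    · rw [← hpa, ← hf.content_eq p hpm]
      simp [content]
  · push Not at hp
    have hne : ∀ i < m, content (f i) ≠ a m := fun i hi => by
      rw [hf.content_eq i hi]; exact hp i hi
    have hne' : ∀ i < m, ∀ x ≤ f i, content x ≠ a m := fun i hi x hx => by
      obtain ⟨q, hq, rfl⟩ := hmem i hi x hx
      exact hne q hq
    obtain ⟨i, hi, h⟩ := hS.exists_adjacent hm0 hm ha
    rw [← hf.content_eq i hi] at h
    obtain ⟨r, c, hri⟩ : ∃ r c, f i = (r, c) := ⟨_, _, rfl⟩
    rcases h with h | h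
    -- Otherwise the box to the left of `f i` is present and has content `a m`.
    · have hc0 : c = 0 := by
        by_contra hc0
        obtain ⟨c, rfl⟩ : ∃ c', c = c' + 1 := ⟨c - 1, by omega⟩
        refine hne' i hi (r, c) (by rw [hri]; simp) ?_
        rw [hri] at h
        simp only [content, Nat.cast_add, Nat.cast_one] at h ⊢
        linear_combination h
      subst hc0
      have hb : content (r + 1, 0) = a m := by
        rw [hri] at h
        simp only [content, Nat.cast_add, Nat.cast_one] at h ⊢
        linear_combination h
      refine ⟨(r + 1, 0), hf.extend (fun j hj h => hne j hj (h ▸ hb)) (fun r' hr' => ?_) (by simp)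
        hb⟩
      obtain rfl : r = r' := by simpa using hr'
      exact ⟨i, hi, hri⟩
    -- Otherwise the box above `f i` is present and has content `a m`.
    · have hr0 : r = 0 := by
        by_contra hr0
        obtain ⟨r, rfl⟩ : ∃ r', r = r' + 1 := ⟨r - 1, by omega⟩
        refine hne' i hi (r, c) (by rw [hri]; simp) ?_
        rw [hri] at h
        simp only [content, Nat.cast_add, Nat.cast_one] at h ⊢
        linear_combination h
      subst hr0
      have hb : content (0, c + 1) = a m := by
        rw [hri] at h
        simp only [content, Nat.cast_add, Nat.cast_one] at h ⊢
        linear_combination h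
      refine ⟨(0, c + 1), hf.extend (fun j hj h => hne j hj (h ▸ hb)) (by simp) (fun c' hc' => ?_)
        hb⟩
      obtain rfl : c = c' := by simpa using hc'
      exact ⟨i, hi, hri⟩

lemma IsContentSystem.exists_isGrowth {S : Set (ℕ → ℂ)} (hS : IsContentSystem n S) {a : ℕ → ℂ}
    (ha : a ∈ S) : ∃ f, IsGrowth a n f := by
  have key : ∀ m ≤ n, ∃ f, IsGrowth a m f := fun m => by
    induction m with
    | zero => exact fun _ => ⟨fun _ => (0, 0), by simp, by simp, by simp⟩
    | succ m ih =>
      intro hm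
      obtain ⟨f, hf⟩ := ih (by omega)
      obtain ⟨b, hb⟩ := hS.exists_extend ha (by omega) hf
      exact ⟨_, hb⟩
  exact key n le_rfl

/-- The standard tableau with the boxes `f 0, …, f (n - 1)`. -/
lemma IsGrowth.exists_tableau {a : ℕ → ℂ} {f : ℕ → ℕ × ℕ} (hf : IsGrowth a n f) :
    ∃ T : Tableau n, ∀ k, T.2.box k = f k := by
  have hinj : Function.Injective fun i : Fin n => f i := fun i j h =>
    Fin.ext (hf.inj i i.2 j j.2 h)
  let μ : YoungDiagram :=
    { cells := Finset.univ.image fun i : Fin n => f i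
      isLowerSet := fun b x hxb hb => by
        simp only [Finset.coe_image, Finset.coe_univ, Set.image_univ, Set.mem_range] at hb ⊢
        obtain ⟨i, rfl⟩ := hb
        obtain ⟨q, hq, h⟩ := hf.lower i i.2 x hxb
        exact ⟨⟨q, lt_of_le_of_lt hq i.2⟩, h⟩ }
  have hμ : ∀ b, b ∈ μ ↔ ∃ i : Fin n, f i = b := fun b => by
    rw [← YoungDiagram.mem_cells]
    simp [μ]
  have hcard : μ.card = n := by
    rw [YoungDiagram.card, Finset.card_image_of_injective _ hinj, Finset.card_fin]
  let E : Fin n ≃ {b : ℕ × ℕ // b ∈ μ} :=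
    Equiv.ofBijective (fun i => ⟨f i, (hμ _).2 ⟨i, rfl⟩⟩)
      ⟨fun i j h => hinj (congrArg Subtype.val h), fun b => by
        obtain ⟨i, hi⟩ := (hμ _).1 b.2
        exact ⟨i, Subtype.ext hi⟩⟩
  have hE : ∀ i, (E i).1 = f i := fun i => rfl
  have hlt : ∀ i j : Fin n, f i ≤ f j → f i ≠ f j → i < j := fun i j h hne => by
    obtain ⟨q, hq, h'⟩ := hf.lower j j.2 _ h
    have := hf.inj q (lt_of_le_of_lt hq j.2) i i.2 h'
    refine lt_of_le_of_ne (Fin.le_def.2 (by omega)) fun e => hne (by rw [e])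
  refine ⟨⟨⟨μ, hcard⟩, ⟨E.symm, fun b b' h h' => ?_, fun b b' h h' => ?_⟩⟩, fun k => ?_⟩
  · obtain ⟨i, rfl⟩ := E.surjective b
    obtain ⟨j, rfl⟩ := E.surjective b'
    rw [E.symm_apply_apply, E.symm_apply_apply]
    exact hlt i j (Prod.le_def.2 ⟨h.le, h'.le⟩) fun e => h'.ne (congrArg Prod.snd e)
  · obtain ⟨i, rfl⟩ := E.surjective b
    obtain ⟨j, rfl⟩ := E.surjective b'
    rw [E.symm_apply_apply, E.symm_apply_apply]
    exact hlt i j (Prod.le_def.2 ⟨h'.le, h.le⟩) fun e => h'.ne (congrArg Prod.fst e)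
  · simp [StandardTableau.box, hE]

lemma IsContentSystem.exists_tableau {S : Set (ℕ → ℂ)} (hS : IsContentSystem n S) {a : ℕ → ℂ}
    (ha : a ∈ S) : ∃ T : Tableau n, ∀ k : Fin n, content (T.2.box k) = a k := by
  obtain ⟨f, hf⟩ := hS.exists_isGrowth ha
  obtain ⟨T, hT⟩ := hf.exists_tableau
  exact ⟨T, fun k => by rw [hT, hf.content_eq k k.2]⟩

/-! ### Addable boxes -/

/-- The bounding square costs nothing, as `b` lies in a diagram with `ν.card + 1` boxes. -/
lemma mem_addable {ν : YoungDiagram} {b : ℕ × ℕ} :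
    b ∈ addable ν ↔ b ∉ ν ∧ IsLowerSet (insert b (ν : Set (ℕ × ℕ))) := by
  refine (@Finset.mem_filter _ _ (_) _ _).trans ?_
  rw [and_iff_right_iff_imp]
  rintro ⟨hb, hl⟩
  let ν' : YoungDiagram := ⟨insert b ν.cells, by rw [Finset.coe_insert]; exact hl⟩
  have hcard : ν'.card = ν.card + 1 := Finset.card_insert_of_notMem (by simpa using hb)
  rw [← hcard]
  exact mem_box_of_mem (μ := ν') (by rw [← YoungDiagram.mem_cells]; simp [ν'])

/-- Boxes on one diagonal are comparable, and adding the larger one requires the smaller one to be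
in `ν` already. This makes the interpolation denominators nonzero. -/
lemma content_injOn_addable {ν : YoungDiagram} {b b' : ℕ × ℕ} (hb : b ∈ addable ν)
    (hb' : b' ∈ addable ν) (h : content b = content b') : b = b' := by
  have key : ∀ b b' : ℕ × ℕ, b ∈ addable ν → b' ∈ addable ν → content b = content b' →
      b.1 ≤ b'.1 → b = b' := fun b b' hb hb' h hle => by
    rw [mem_addable] at hb hb'
    have h' := content_eq h
    have hmem := hb'.2 (Prod.le_def.2 ⟨hle, by omega⟩ : b ≤ b') (Set.mem_insert _ _)
    exact (Set.mem_insert_iff.1 hmem).resolve_right hb.1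
  rcases le_total b.1 b'.1 with hle | hle
  · exact key b b' hb hb' h hle
  · exact (key b' b hb' hb h.symm hle).symm

namespace StandardTableau

lemma box_mem (T : StandardTableau n μ) (k : Fin n) : T.box k ∈ μ := (T.entry.symm k).2

lemma box_entry (T : StandardTableau n μ) {b : ℕ × ℕ} (hb : b ∈ μ) : T.box (T.entry ⟨b, hb⟩) = b := by
  simp [box]

lemma entry_box (T : StandardTableau n μ) (k : Fin n) : T.entry ⟨T.box k, T.box_mem k⟩ = k := by
  simp [box]

lemma box_injective (T : StandardTableau n μ) : Function.Injective T.box :=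
  Subtype.val_injective.comp T.entry.symm.injective

lemma mem_shapeBelow (T : StandardTableau n μ) {k : Fin n} {b : ℕ × ℕ} :
    b ∈ T.shapeBelow k ↔ ∃ i < k, T.box i = b := by
  rw [← YoungDiagram.mem_cells, shapeBelow]
  simp

lemma box_mem_addable (T : StandardTableau n μ) (k : Fin n) :
    T.box k ∈ addable (T.shapeBelow k) := by
  rw [mem_addable]
  constructor
  · rw [T.mem_shapeBelow]
    rintro ⟨i, hi, h⟩
    exact hi.ne (T.box_injective h)
  · rintro b x hxb (rfl | hb)
    · have hx : x ∈ μ := μ.isLowerSet hxb (T.box_mem k)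
      have h := T.entry_mono hxb hx (T.box_mem k)
      rw [entry_box] at h
      rcases h.eq_or_lt with h | h
      · left
        rw [← h, box_entry]
      · exact Or.inr (T.mem_shapeBelow.2 ⟨_, h, T.box_entry hx⟩)
    · exact Or.inr ((T.shapeBelow k).isLowerSet hxb hb)

lemma shapeBelow_congr {ν : YoungDiagram} {T : StandardTableau n μ} {T' : StandardTableau n ν}
    {k : Fin n} (h : ∀ i < k, T.box i = T'.box i) : T.shapeBelow k = T'.shapeBelow k := by
  ext b
  simp only [YoungDiagram.mem_cells, mem_shapeBelow]
  exact exists_congr fun i => and_congr_right fun hi => by rw [h i hi]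

end StandardTableau

lemma Tableau.ext_box {T T' : Tableau n} (h : ∀ k, T.2.box k = T'.2.box k) : T = T' := by
  obtain ⟨⟨μ, hμ⟩, T⟩ := T
  obtain ⟨⟨ν, hν⟩, T'⟩ := T'
  simp only at h
  obtain rfl : μ = ν := by
    ext b
    rw [YoungDiagram.mem_cells, YoungDiagram.mem_cells]
    constructor
    · intro hb
      rw [← T.box_entry hb, h]
      exact T'.box_mem _
    · intro hb
      rw [← T'.box_entry hb, ← h]
      exact T.box_mem _
  have : T = T' := by
    refine StandardTableau.ext (Equiv.ext fun b => ?_)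
    have h1 : T'.box (T.entry b) = T'.box (T'.entry b) := by
      rw [← h, T.box_entry b.2, T'.box_entry b.2]
    exact T'.box_injective h1
  rw [this]

/-- Distinct tableaux have a first label at which they differ. -/
lemma Tableau.exists_first_ne {T T' : Tableau n} (h : T ≠ T') :
    ∃ k, T.2.box k ≠ T'.2.box k ∧ T.2.shapeBelow k = T'.2.shapeBelow k := by
  classical
  have hne : (Finset.univ.filter fun k => T.2.box k ≠ T'.2.box k).Nonempty := by
    by_contra hcon
    refine h (Tableau.ext_box fun k => ?_)
    by_contra hk
    exact hcon ⟨k, by simpa using hk⟩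
  obtain ⟨k, hk, hmin⟩ := Finset.exists_min_image _ id hne
  refine ⟨k, by simpa using hk, StandardTableau.shapeBelow_congr fun i hi => ?_⟩
  by_contra hcon
  exact (hmin i (by simpa using hcon)).not_gt hi

lemma Tableau.exists_content_ne {T T' : Tableau n} (h : T ≠ T') :
    ∃ k, content (T.2.box k) ≠ content (T'.2.box k) := by
  obtain ⟨k, hk, hs⟩ := Tableau.exists_first_ne h
  exact ⟨k, fun hc => hk (content_injOn_addable (T.2.box_mem_addable k)
    (hs ▸ T'.2.box_mem_addable k) hc)⟩

end Tableaux

/-! ### The joint spectrum in a unitary representation. -/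

section Representation

variable {n : ℕ} {V : Type*} [NormedAddCommGroup V] [InnerProductSpace ℂ V]
  {ρ : GroupAlg n →ₐ[ℂ] Module.End ℂ V}

lemma isSymmetric_jucysMurphy
    (hρ : ∀ i j, (ρ (MonoidAlgebra.single (Equiv.swap i j) 1)).IsSymmetric) (k : Fin n) :
    (ρ (jucysMurphy k)).IsSymmetric := by
  rw [jucysMurphy, map_sum]
  exact LinearMap.isSymmetric_sum _ fun i _ => hρ i k

lemma swap_swap_apply (i j : Fin n) (v : V) :
    ρ (MonoidAlgebra.single (Equiv.swap i j) 1)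
      (ρ (MonoidAlgebra.single (Equiv.swap i j) 1) v) = v := by
  rw [← Module.End.mul_apply, ← map_mul, MonoidAlgebra.single_mul_single, Equiv.swap_mul_self,
    mul_one, ← MonoidAlgebra.one_def, map_one, Module.End.one_apply]

lemma jucysMurphy_succ_swap_apply {i j : Fin n} (h : (j : ℕ) = i + 1) {a : ℂ} {v : V}
    (hv : ρ (jucysMurphy i) v = a • v) :
    ρ (jucysMurphy j) (ρ (MonoidAlgebra.single (Equiv.swap i j) 1) v) =
      a • ρ (MonoidAlgebra.single (Equiv.swap i j) 1) v + v := by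
  rw [← Module.End.mul_apply, ← map_mul, ← swap_mul_jucysMurphy h, map_add, map_mul, map_one,
    LinearMap.add_apply, Module.End.mul_apply, hv, map_smul, Module.End.one_apply]

lemma jucysMurphy_swap_apply {i j : Fin n} (h : (j : ℕ) = i + 1) {b : ℂ} {v : V}
    (hv : ρ (jucysMurphy j) v = b • v) :
    ρ (jucysMurphy i) (ρ (MonoidAlgebra.single (Equiv.swap i j) 1) v) =
      b • ρ (MonoidAlgebra.single (Equiv.swap i j) 1) v - v := by
  have h1 := congrArg (fun x => ρ (MonoidAlgebra.single (Equiv.swap i j) 1)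
    (ρ x (ρ (MonoidAlgebra.single (Equiv.swap i j) 1) v))) (swap_mul_jucysMurphy h)
  simp only [map_add, map_mul, map_one, LinearMap.add_apply, Module.End.mul_apply,
    Module.End.one_apply, swap_swap_apply, hv, map_smul] at h1
  rw [← h1, add_sub_cancel_right]

/-- Consecutive joint eigenvalues of the Jucys-Murphy elements differ. -/
lemma eigenvalue_ne_succ
    (hρ : ∀ i j, (ρ (MonoidAlgebra.single (Equiv.swap i j) 1)).IsSymmetric)
    {i j : Fin n} (h : (j : ℕ) = i + 1) {a b : ℂ} {v : V} (hv0 : v ≠ 0)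
    (hi : ρ (jucysMurphy i) v = a • v) (hj : ρ (jucysMurphy j) v = b • v) : a ≠ b := by
  rintro rfl
  have hm := isSymmetric_jucysMurphy hρ i
  have hreal : (starRingEnd ℂ) a = a := hm.conj_eigenvalue_eq_self
    (Module.End.hasEigenvalue_of_hasEigenvector
      ⟨Module.End.mem_eigenspace_iff.2 hi, hv0⟩)
  -- With `s` the transposition, moving `m_i` across `⟨v, s v⟩` gives `a⟨v, s v⟩ = a⟨v, s v⟩ - ⟨v,
  -- v⟩`.
  have h1 := hm v (ρ (MonoidAlgebra.single (Equiv.swap i j) 1) v)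
  rw [hi, jucysMurphy_swap_apply h hj, inner_smul_left, inner_sub_right, inner_smul_right,
    hreal] at h1
  exact hv0 (inner_self_eq_zero (𝕜 := ℂ).1 (by linear_combination h1))

/-- If two consecutive joint eigenvalues differ by `1` then the joint eigenvector is an eigenvector
of the transposition. -/
lemma swap_apply_of_eigenvalue_add
    (hρ : ∀ i j, (ρ (MonoidAlgebra.single (Equiv.swap i j) 1)).IsSymmetric)
    {i j : Fin n} (h : (j : ℕ) = i + 1) {a d : ℂ} (hd : d * d = 1) {v : V}
    (hi : ρ (jucysMurphy i) v = a • v) (hj : ρ (jucysMurphy j) v = (a + d) • v) :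
    ρ (MonoidAlgebra.single (Equiv.swap i j) 1) v = d • v := by
  have hm := isSymmetric_jucysMurphy hρ i
  have hd0 : d ≠ 0 := by rintro rfl; simp at hd
  set s := ρ (MonoidAlgebra.single (Equiv.swap i j) 1) with hs
  -- This `w` satisfies `m_i w = (a + d) w`, so it is orthogonal to `v`. Since also `s w = -d w`, it
  -- follows that `⟨w, w⟩ = ⟨w, s v⟩ = ⟨s w, v⟩ = 0`.
  set w := s v - d • v with hw
  have hmw : ρ (jucysMurphy i) w = (a + d) • w := by
    rw [hw, map_sub, map_smul, hi, hs, jucysMurphy_swap_apply h hj]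
    linear_combination (norm := module) hd • v
  have hsw : s w = -d • w := by
    rw [hw, map_sub, map_smul, hs, swap_swap_apply]
    linear_combination (norm := module) -hd • v
  have horth : inner ℂ w v = 0 := by
    have := hm.orthogonalFamily_eigenspaces.pairwise (i := a + d) (j := a) (by simpa using hd0)
      (Module.End.mem_eigenspace_iff.2 hmw) v (Module.End.mem_eigenspace_iff.2 hi)
    simpa [inner_eq_zero_symm] using this
  have hw0 : inner ℂ w w = 0 := by
    have h1 : inner ℂ w w = inner ℂ w (s v) - d * inner ℂ w v := by
      conv_lhs => rw [hw, inner_sub_right, inner_smul_right]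
    rw [h1, ← hρ i j, ← hs, hsw, inner_smul_left, horth]
    simp
  rw [inner_self_eq_zero, hw, sub_eq_zero] at hw0
  exact hw0

lemma braid_swap {i j k : Fin n} (hij : i ≠ j) (hjk : j ≠ k) (hik : i ≠ k) :
    Equiv.swap i j * Equiv.swap j k * Equiv.swap i j =
      Equiv.swap j k * Equiv.swap i j * Equiv.swap j k := by
  rw [Equiv.swap_mul_swap_mul_swap hij hik, Equiv.swap_comm i j, Equiv.swap_comm j k,
    Equiv.swap_mul_swap_mul_swap hjk.symm hik.symm, Equiv.swap_comm]

/-- For eigenvalues `a, a + d, a` the two transpositions would act on `v` by `d` and `-d`, and the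
braid relation would give `-d³ = d³`. -/
lemma eigenvalue_ne_of_adjacent
    (hρ : ∀ i j, (ρ (MonoidAlgebra.single (Equiv.swap i j) 1)).IsSymmetric)
    {i j k : Fin n} (h : (j : ℕ) = i + 1) (h' : (k : ℕ) = j + 1) {a b c d : ℂ} (hd : d * d = 1)
    {v : V} (hv0 : v ≠ 0)
    (hi : ρ (jucysMurphy i) v = a • v) (hj : ρ (jucysMurphy j) v = b • v)
    (hk : ρ (jucysMurphy k) v = c • v) (hb : b = a + d) : c ≠ a := by
  rintro rfl
  subst hb
  have hs := swap_apply_of_eigenvalue_add hρ h hd hi hj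
  have ht := swap_apply_of_eigenvalue_add hρ h' (d := -d) (by rw [neg_mul_neg, hd]) hj
    (by rw [hk]; congr 1; ring)
  have hbr := congrArg (fun σ => ρ (MonoidAlgebra.single σ 1) v)
    (braid_swap (i := i) (j := j) (k := k) (fun e => by rw [e] at h; omega)
      (fun e => by rw [e] at h'; omega) (fun e => by rw [e] at h; omega))
  have hmul : ∀ σ τ : Equiv.Perm (Fin n), (MonoidAlgebra.single (σ * τ) 1 : GroupAlg n) =
      MonoidAlgebra.single σ 1 * MonoidAlgebra.single τ 1 := fun σ τ => by
    rw [MonoidAlgebra.single_mul_single, mul_one]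
  simp only [hmul, map_mul, Module.End.mul_apply, hs, ht, map_smul, smul_smul] at hbr
  have h0 : (2 * (d * d) * d) • v = 0 := by linear_combination (norm := module) -hbr
  rw [hd, mul_one, smul_eq_zero] at h0
  rcases h0 with h0 | h0
  · have : d = 0 := by simpa using h0
    simp [this] at hd
  · exact hv0 h0

/-- The joint spectrum of the Jucys-Murphy elements in a representation. -/
def jointSpectrum (ρ : GroupAlg n →ₐ[ℂ] Module.End ℂ V) : Set (ℕ → ℂ) :=
  {a | ∃ v : V, v ≠ 0 ∧ ∀ k : Fin n, ρ (jucysMurphy k) v = a k • v}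

lemma isContentSystem_jointSpectrum
    (hρ : ∀ i j, (ρ (MonoidAlgebra.single (Equiv.swap i j) 1)).IsSymmetric) :
    IsContentSystem n (jointSpectrum ρ) where
  zero := by
    rintro a ⟨v, hv0, hv⟩ hn
    have h := hv ⟨0, hn⟩
    rw [jucysMurphy, Finset.sum_eq_zero, map_zero, LinearMap.zero_apply] at h
    · exact (smul_eq_zero.1 h.symm).resolve_right hv0
    · intro i hi
      exact absurd (Finset.mem_filter.1 hi).2 (by simp [Fin.lt_def])
  ne := by
    rintro a ⟨v, hv0, hv⟩ i hi
    exact eigenvalue_ne_succ hρ (i := ⟨i, by omega⟩) (j := ⟨i + 1, hi⟩) rfl hv0 (hv _) (hv _)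
  swap := by
    rintro a ⟨v, hv0, hv⟩ i hi h1 h2
    set i' : Fin n := ⟨i, by omega⟩ with hi'
    set j' : Fin n := ⟨i + 1, hi⟩ with hj'
    set s := ρ (MonoidAlgebra.single (Equiv.swap i' j') 1) with hs
    have hab : a (i + 1) - a i ≠ 0 := sub_ne_zero.2
      (eigenvalue_ne_succ hρ (i := i') (j := j') rfl hv0 (hv _) (hv _)).symm
    have hsub : (a (i + 1) - a i) * (a (i + 1) - a i)⁻¹ = 1 := mul_inv_cancel₀ hab
    set d := (a (i + 1) - a i)⁻¹ with hd
    -- With `d = 1 / (a (i + 1) - a i)` this vector has the two eigenvalues exchanged. If it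
    -- vanished, `s² = 1` would force `d² = 1`, which the hypotheses exclude.
    refine ⟨s v - d • v, fun h0 => ?_, fun k => ?_⟩
    · have hsv : s v = d • v := sub_eq_zero.1 h0
      have hdd : (d * d) • v = (1 : ℂ) • v := by
        rw [mul_smul, ← hsv, ← map_smul, ← hsv, hs, swap_swap_apply, one_smul]
      have hdd' : d * d = 1 := smul_left_injective ℂ hv0 hdd
      rcases mul_self_eq_one_iff.1 hdd' with h | h
      · exact h1 (by linear_combination hsub - (a (i + 1) - a i) * h)
      · exact h2 (by linear_combination -hsub + (a (i + 1) - a i) * h)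
    · rcases lt_trichotomy (k : ℕ) i with hk | hk | hk
      · have hc := swap_commute_jucysMurphy_of_gt (k := k) (i := i') (j := j') (by
          rw [Fin.lt_def]; exact hk) (by rw [Fin.lt_def]; simp only [hj']; omega)
        have hc' : ρ (jucysMurphy k) (s v) = a k • s v := by
          rw [hs, ← Module.End.mul_apply, ← map_mul, ← hc.eq, map_mul, Module.End.mul_apply, hv,
            map_smul]
        rw [map_sub, map_smul, hc', hv, Function.comp_apply,
          Equiv.swap_apply_of_ne_of_ne (by omega) (by omega)]
        module
      · obtain rfl : k = i' := Fin.ext hk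
        have h3 := jucysMurphy_swap_apply (i := i') (j := j') rfl (hv j')
        rw [map_sub, map_smul, hs, h3, hv, Function.comp_apply, ← hs]
        simp only [hi', hj', Equiv.swap_apply_left]
        linear_combination (norm := module) hsub • v
      · rcases (Nat.succ_le_of_lt hk).eq_or_lt with hk | hk
        · obtain rfl : k = j' := Fin.ext hk.symm
          have h3 := jucysMurphy_succ_swap_apply (i := i') (j := j') rfl (hv i')
          rw [map_sub, map_smul, hs, h3, hv, Function.comp_apply, ← hs]
          simp only [hi', hj', Equiv.swap_apply_right]
          linear_combination (norm := module) -hsub • v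
        · have hc := swap_commute_jucysMurphy_of_lt (k := k) (i := i') (j := j') (by
            rw [Fin.lt_def]; simp only [hi']; omega) (by rw [Fin.lt_def]; exact hk)
          have hc' : ρ (jucysMurphy k) (s v) = a k • s v := by
            rw [hs, ← Module.End.mul_apply, ← map_mul, ← hc.eq, map_mul, Module.End.mul_apply, hv,
              map_smul]
          rw [map_sub, map_smul, hc', hv, Function.comp_apply,
            Equiv.swap_apply_of_ne_of_ne (by omega) (by omega)]
          module
  not_add := by
    rintro a ⟨v, hv0, hv⟩ i hi h
    exact eigenvalue_ne_of_adjacent hρ (i := ⟨i, by omega⟩) (j := ⟨i + 1, by omega⟩)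
      (k := ⟨i + 2, hi⟩) rfl rfl (d := 1) (by norm_num) hv0 (hv _) (hv _) (hv _) h
  not_sub := by
    rintro a ⟨v, hv0, hv⟩ i hi h
    exact eigenvalue_ne_of_adjacent hρ (i := ⟨i, by omega⟩) (j := ⟨i + 1, by omega⟩)
      (k := ⟨i + 2, hi⟩) rfl rfl (d := -1) (by norm_num) hv0 (hv _) (hv _) (hv _) h

/-- The joint eigenvectors with the contents of a tableau as eigenvalues span the space. -/
lemma eq_zero_of_forall_tableau [FiniteDimensional ℂ V]
    (hρ : ∀ i j, (ρ (MonoidAlgebra.single (Equiv.swap i j) 1)).IsSymmetric) {x : GroupAlg n}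
    (hx : ∀ (T : Tableau n) (v : V), (∀ k, ρ (jucysMurphy k) v = content (T.2.box k) • v) →
      ρ x v = 0) : ρ x = 0 := by
  have htop := LinearMap.IsSymmetric.iSup_iInf_eq_top_of_commute
    (T := fun k : Fin n => ρ (jucysMurphy k)) (isSymmetric_jucysMurphy hρ)
    (fun j k _ => (jucysMurphy_commute j k).map ρ)
  have hle : (⊤ : Submodule ℂ V) ≤ LinearMap.ker (ρ x) := by
    rw [← htop, iSup_le_iff]
    intro χ v hv
    rw [LinearMap.mem_ker]
    have hv' : ∀ k, ρ (jucysMurphy k) v = χ k • v := fun k =>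
      Module.End.mem_eigenspace_iff.1 ((Submodule.mem_iInf _).1 hv k)
    by_cases hv0 : v = 0
    · rw [hv0, map_zero]
    -- The value 0 beyond `n` is arbitrary; the spectrum only constrains the first `n` entries.
    obtain ⟨T, hT⟩ := (isContentSystem_jointSpectrum hρ).exists_tableau
      (a := fun k => if h : k < n then χ ⟨k, h⟩ else 0)
      ⟨v, hv0, fun k => by simpa using hv' k⟩
    exact hx T v fun k => by rw [hv', hT]; simp
  exact LinearMap.ext fun v => hle Submodule.mem_top

end Representation

/-! ### Young's idempotents and their uniqueness. -/

section Idempotents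

variable {n : ℕ}

/-- The group algebra as a Euclidean space, with the permutations as an orthonormal basis. -/
def euclideanEquiv (n : ℕ) :
    GroupAlg n ≃ₗ[ℂ] EuclideanSpace ℂ (Equiv.Perm (Fin n)) :=
  (MonoidAlgebra.basis (Equiv.Perm (Fin n)) ℂ).equivFun.trans (WithLp.linearEquiv 2 ℂ _).symm

lemma euclideanEquiv_apply (x : GroupAlg n) (σ : Equiv.Perm (Fin n)) :
    euclideanEquiv n x σ = x.coeff σ := rfl

/-- The left regular representation on the Euclidean space. -/
def euclideanRep (n : ℕ) :
    GroupAlg n →ₐ[ℂ] Module.End ℂ (EuclideanSpace ℂ (Equiv.Perm (Fin n))) :=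
  ((LinearEquiv.conjAlgEquiv ℂ (euclideanEquiv n)) : _ →ₐ[ℂ] _).comp
    (Algebra.lmul ℂ (GroupAlg n))

lemma euclideanRep_apply (x : GroupAlg n) (v : EuclideanSpace ℂ (Equiv.Perm (Fin n))) :
    euclideanRep n x v = euclideanEquiv n (x * (euclideanEquiv n).symm v) := rfl

lemma isSymmetric_euclideanRep_swap (i j : Fin n) :
    (euclideanRep n (MonoidAlgebra.single (Equiv.swap i j) 1)).IsSymmetric := by
  intro v w
  obtain ⟨x, rfl⟩ := (euclideanEquiv n).surjective v
  obtain ⟨y, rfl⟩ := (euclideanEquiv n).surjective w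
  rw [euclideanRep_apply, euclideanRep_apply, LinearEquiv.symm_apply_apply,
    LinearEquiv.symm_apply_apply, PiLp.inner_apply, PiLp.inner_apply]
  refine Fintype.sum_equiv (Equiv.mulLeft (Equiv.swap i j)) _ _ fun σ => ?_
  simp only [euclideanEquiv_apply, MonoidAlgebra.coeff_single_mul_apply, Equiv.swap_inv,
    Equiv.coe_mulLeft, one_mul, Equiv.swap_mul_self_mul]

/-- An element of the group algebra is determined by its action on the joint eigenvectors of the
Jucys-Murphy elements, all of which belong to tableaux. -/
lemma eq_of_forall_tableau {x x' : GroupAlg n}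
    (hx : ∀ (T : Tableau n) (y : GroupAlg n),
      (∀ k, jucysMurphy k * y = content (T.2.box k) • y) → x * y = x' * y) : x = x' := by
  have h := eq_zero_of_forall_tableau (ρ := euclideanRep n) (x := x - x')
    isSymmetric_euclideanRep_swap fun T v hv => by
      obtain ⟨y, rfl⟩ := (euclideanEquiv n).surjective v
      rw [euclideanRep_apply, LinearEquiv.symm_apply_apply, sub_mul, hx T y, sub_self, map_zero]
      intro k
      have := hv k
      rwa [euclideanRep_apply, LinearEquiv.symm_apply_apply, ← map_smul,
        (euclideanEquiv n).injective.eq_iff] at this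
  -- The regular representation is faithful: evaluate at 1.
  have h1 := LinearMap.congr_fun h (euclideanEquiv n 1)
  rw [euclideanRep_apply, LinearEquiv.symm_apply_apply, mul_one, LinearMap.zero_apply,
    LinearEquiv.map_eq_zero_iff, sub_eq_zero] at h1
  exact h1

lemma aeval_mul_of_mul_eq_smul {A : Type*} [Ring A] [Algebra ℂ A] {x y : A} {c : ℂ}
    (h : x * y = c • y) (p : Polynomial ℂ) : Polynomial.aeval x p * y = p.eval c • y := by
  induction p using Polynomial.induction_on' with
  | add p q hp hq => rw [map_add, add_mul, hp, hq, Polynomial.eval_add, add_smul]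
  | monomial m a =>
    have hpow : x ^ m * y = c ^ m • y := by
      induction m with
      | zero => simp
      | succ m ih => rw [pow_succ, mul_assoc, h, mul_smul_comm, ih, smul_smul, pow_succ, mul_comm]
    rw [Polynomial.aeval_monomial, Polynomial.eval_monomial, mul_assoc, hpow, ← Algebra.smul_def,
      smul_smul]

lemma ofFn_prod_mul_of_mul_eq_smul {A : Type*} [Ring A] [Algebra ℂ A] {y : A} {m : ℕ}
    {g : Fin m → A} {c : Fin m → ℂ} (h : ∀ k, g k * y = c k • y) :
    (List.ofFn g).prod * y = (∏ k, c k) • y := by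
  induction m with
  | zero => simp
  | succ m ih =>
    rw [List.ofFn_succ, List.prod_cons, mul_assoc, ih fun k => h k.succ, mul_smul_comm, h,
      smul_smul, Fin.prod_univ_succ, mul_comm]

/-- `e_T` acts on the joint eigenvectors belonging to `T'` by the Kronecker delta. -/
lemma youngIdempotent_mul {T T' : Tableau n} {y : GroupAlg n}
    (hy : ∀ k, jucysMurphy k * y = content (T'.2.box k) • y) [Decidable (T = T')] :
    youngIdempotent T.2 * y = if T = T' then y else 0 := by
  rw [youngIdempotent, ofFn_prod_mul_of_mul_eq_smul fun k =>
    show interpolationFactor T.2 k * y = _ from aeval_mul_of_mul_eq_smul (hy k) _]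
  simp only [Polynomial.eval_prod, Polynomial.eval_mul, Polynomial.eval_sub, Polynomial.eval_C,
    Polynomial.eval_X]
  split_ifs with h
  · subst h
    rw [Finset.prod_eq_one, one_smul]
    refine fun k _ => Finset.prod_eq_one fun b hb => ?_
    rw [Finset.mem_erase] at hb
    refine inv_mul_cancel₀ (sub_ne_zero.2 fun hc => hb.1 ?_)
    exact (content_injOn_addable (T.2.box_mem_addable k) hb.2 hc).symm
  -- At the first label where the tableaux differ, the box of `T'` is one of the interpolation nodes
  -- for `T`, so that factor vanishes.
  · obtain ⟨k, hk, hs⟩ := Tableau.exists_first_ne h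
    rw [Finset.prod_eq_zero (Finset.mem_univ k), zero_smul]
    refine Finset.prod_eq_zero (i := T'.2.box k) ?_ (by rw [sub_self, mul_zero])
    exact Finset.mem_erase.2 ⟨hk.symm, hs ▸ T'.2.box_mem_addable k⟩

/-- Each relation is tested on an eigenvector `y` belonging to a tableau `R`, where every `e_T` acts
by a Kronecker delta. -/
lemma isYoungOrthogonal_youngIdempotent :
    IsYoungOrthogonal fun T : Tableau n => youngIdempotent T.2 where
  mul_eq T T' := eq_of_forall_tableau fun R y hy => by
    classical
    rw [mul_assoc, youngIdempotent_mul hy]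
    split_ifs <;> simp_all [youngIdempotent_mul hy]
  sum_eq := eq_of_forall_tableau fun R y hy => by
    classical
    simp [Finset.sum_mul, youngIdempotent_mul hy]
  jucysMurphy_mul k T := eq_of_forall_tableau fun R y hy => by
    classical
    rw [mul_assoc, smul_mul_assoc, youngIdempotent_mul hy]
    split_ifs with h
    · rw [hy, h]
    · simp
  mul_jucysMurphy k T := eq_of_forall_tableau fun R y hy => by
    classical
    rw [mul_assoc, hy, mul_smul_comm, smul_mul_assoc, youngIdempotent_mul hy]
    split_ifs with h
    · rw [h]
    · simp

/-- Evaluating `e_T m_k e'_T'` in two ways kills `e_T e'_T'` for `T ≠ T'`, as some content differs.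
Expanding 1 in either family then gives `e_T = e_T e'_T = e'_T`. -/
lemma IsYoungOrthogonal.eq {e e' : Tableau n → GroupAlg n} (he : IsYoungOrthogonal e)
    (he' : IsYoungOrthogonal e') : e = e' := by
  have hne : ∀ T T', T ≠ T' → e T * e' T' = 0 := fun T T' h => by
    obtain ⟨k, hk⟩ := Tableau.exists_content_ne h
    have h1 : content (T.2.box k) • (e T * e' T') = content (T'.2.box k) • (e T * e' T') := by
      rw [← smul_mul_assoc, ← he.mul_jucysMurphy, mul_assoc, he'.jucysMurphy_mul, mul_smul_comm]
    rw [← sub_eq_zero, ← sub_smul, smul_eq_zero] at h1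
    exact h1.resolve_left (sub_ne_zero.2 hk)
  funext T
  calc e T = e T * ∑ T', e' T' := by rw [he'.sum_eq, mul_one]
    _ = e T * e' T := by
      rw [Finset.mul_sum]
      exact Finset.sum_eq_single T (fun T' _ h => hne T T' h.symm) (by simp)
    _ = (∑ T', e T') * e' T := by
      rw [Finset.sum_mul]
      exact (Finset.sum_eq_single T (fun T' _ h => hne T' T h) (by simp)).symm
    _ = e' T := by rw [he.sum_eq, one_mul]

lemma isYoungOrthogonal_iff {e : Tableau n → GroupAlg n} :
    IsYoungOrthogonal e ↔ e = fun T => youngIdempotent T.2 :=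
  ⟨fun h => h.eq isYoungOrthogonal_youngIdempotent,
    fun h => h ▸ isYoungOrthogonal_youngIdempotent⟩

end Idempotents

/-! ### The Gram matrix and Jucys' factorization. -/

section Gram

variable {n : ℕ}

/-- The number of maps from the letters to `Fin τ` which are constant on the cycles of `σ`. -/
def fixCount (τ : ℕ) (σ : Equiv.Perm (Fin n)) : ℕ :=
  Nat.card {b : Fin n → Fin τ // b ∘ σ = b}

lemma fixCount_eq_pow (τ : ℕ) (σ : Equiv.Perm (Fin n)) : fixCount τ σ = τ ^ numCycles σ := by
  have hiter : ∀ b : Fin n → Fin τ, b ∘ σ = b → ∀ m : ℕ, ∀ x, b ((σ ^ m) x) = b x := by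
    intro b hb m
    induction m with
    | zero => simp
    | succ m ih =>
      intro x
      rw [pow_succ, Equiv.Perm.mul_apply, ih]
      exact congrFun hb x
  have hsame : ∀ b : Fin n → Fin τ, b ∘ σ = b → ∀ x y, σ.SameCycle x y → b x = b y := by
    intro b hb x y h
    obtain ⟨m, rfl⟩ := h.exists_nat_pow_eq
    exact (hiter b hb m x).symm
  let E : {b : Fin n → Fin τ // b ∘ σ = b} ≃
      (Quotient (Equiv.Perm.SameCycle.setoid σ) → Fin τ) :=
    { toFun := fun b q => Quotient.lift b.1 (hsame b.1 b.2) q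
      invFun := fun c => ⟨fun x => c (Quotient.mk _ x), funext fun x =>
        congrArg c (Quotient.sound (show σ.SameCycle (σ x) x from
          Equiv.Perm.sameCycle_apply_left.2 (Equiv.Perm.SameCycle.refl σ x)))⟩
      left_inv := fun b => rfl
      right_inv := fun c => funext fun q => Quotient.inductionOn q fun _ => rfl }
  rw [fixCount, Nat.card_congr E, Nat.card_fun, Nat.card_fin, numCycles]

lemma fixCount_inv (τ : ℕ) (σ : Equiv.Perm (Fin n)) : fixCount τ σ⁻¹ = fixCount τ σ := by
  refine Nat.card_congr (Equiv.subtypeEquivRight fun b => ?_)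
  rw [Equiv.Perm.inv_def, Equiv.comp_symm_eq, eq_comm]

lemma fixCount_mul_comm (τ : ℕ) (σ π : Equiv.Perm (Fin n)) :
    fixCount τ (σ * π) = fixCount τ (π * σ) := by
  refine Nat.card_congr ((Equiv.arrowCongr σ.symm (Equiv.refl _)).subtypeEquiv fun b => ?_)
  change b ∘ (σ * π) = b ↔ (b ∘ σ) ∘ (π * σ) = b ∘ σ
  refine ⟨fun h => funext fun x => congrFun h (σ x), fun h => funext fun x => ?_⟩
  have hx := congrFun h (σ.symm x)
  simpa using hx

/-- The trace counts the `b` with `b ∘ σ⁻¹ = b ∘ σ'⁻¹`. -/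
lemma gramMatrix_apply (τ : ℕ) (σ σ' : Equiv.Perm (Fin n)) :
    gramMatrix n τ σ σ' = fixCount τ (σ⁻¹ * σ') := by
  classical
  rw [gramMatrix, Matrix.of_apply, Matrix.trace, fixCount, Nat.card_eq_fintype_card,
    Fintype.card_subtype, Finset.card_filter, Nat.cast_sum]
  refine Finset.sum_congr rfl fun b _ => ?_
  rw [Matrix.diag_apply, Matrix.mul_apply]
  simp only [Matrix.transpose_apply, permOperator, Matrix.of_apply, mul_ite, mul_one, mul_zero]
  rw [Finset.sum_ite_eq']
  simp only [Finset.mem_univ, if_true, Nat.cast_ite, Nat.cast_one, Nat.cast_zero]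
  refine if_congr ?_ rfl rfl
  refine ⟨fun h => funext fun x => ?_, fun h => funext fun x => ?_⟩
  · have hx := congrFun h (σ' x)
    simpa using hx.symm
  · have hx := congrFun h (σ'.symm x)
    simpa using hx.symm

/-- Multiplying by `(i j)` inserts the fixed point `j` into the cycle of `i`: its colour, free
before, must now equal that of `i`. -/
lemma mul_fixCount_mul_swap (τ : ℕ) {σ : Equiv.Perm (Fin n)} {i j : Fin n} (hj : σ j = j)
    (hij : i ≠ j) : τ * fixCount τ (σ * Equiv.swap i j) = fixCount τ σ := by
  have hσ : ∀ x, x ≠ j → σ x ≠ j := fun x hx h => hx (σ.injective (h.trans hj.symm))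
  let E : {b : Fin n → Fin τ // b ∘ σ = b} ≃
      Fin τ × {b : Fin n → Fin τ // b ∘ (σ * Equiv.swap i j) = b} :=
    { toFun := fun b => (b.1 j, ⟨Function.update b.1 j (b.1 i), funext fun x => by
        have hb := fun x => congrFun b.2 x
        simp only [Function.comp_apply] at hb
        simp only [Function.comp_apply, Equiv.Perm.mul_apply]
        by_cases hxj : x = j
        · subst hxj
          rw [Equiv.swap_apply_right, Function.update_of_ne (hσ i hij), Function.update_self, hb]
        by_cases hxi : x = i
        · subst hxi
          rw [Equiv.swap_apply_left, hj, Function.update_self, Function.update_of_ne hxj]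
        · rw [Equiv.swap_apply_of_ne_of_ne hxi hxj, Function.update_of_ne (hσ x hxj),
            Function.update_of_ne hxj, hb]⟩)
      invFun := fun p => ⟨Function.update p.2.1 j p.1, funext fun x => by
        have hb := fun x => congrFun p.2.2 x
        simp only [Function.comp_apply, Equiv.Perm.mul_apply] at hb
        have hbi := hb i
        have hbj := hb j
        rw [Equiv.swap_apply_left, hj] at hbi
        rw [Equiv.swap_apply_right] at hbj
        rw [Function.comp_apply]
        by_cases hxj : x = j
        · rw [hxj, hj]
        rw [Function.update_of_ne (hσ x hxj), Function.update_of_ne hxj]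
        by_cases hxi : x = i
        · rw [hxi, hbj, hbi]
        · have := hb x
          rwa [Equiv.swap_apply_of_ne_of_ne hxi hxj] at this⟩
      left_inv := fun b => Subtype.ext (by simp)
      right_inv := fun p => by
        have hbi := congrFun p.2.2 i
        rw [Function.comp_apply, Equiv.Perm.mul_apply, Equiv.swap_apply_left, hj] at hbi
        refine Prod.ext (by simp) (Subtype.ext ?_)
        simp [Function.update_of_ne hij, ← hbi] }
  rw [fixCount, fixCount, Nat.card_congr E, Nat.card_prod, Nat.card_fin]

open Classical in
/-- The part of the Gram element supported on the permutations of the first `j` letters. -/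
def gramElement (n τ j : ℕ) : GroupAlg n :=
  ∑ σ ∈ Finset.univ.filter (fun σ : Equiv.Perm (Fin n) => ∀ x : Fin n, j ≤ x → σ x = x),
    MonoidAlgebra.single σ (fixCount τ σ : ℂ)

lemma gramElement_zero (n τ : ℕ) : gramElement n τ 0 = (τ : ℂ) ^ n • 1 := by
  have h : Finset.univ.filter (fun σ : Equiv.Perm (Fin n) => ∀ x : Fin n, 0 ≤ (x : ℕ) → σ x = x) =
      {1} := by
    ext σ
    simp [Equiv.ext_iff]
  rw [gramElement]
  convert (Finset.sum_congr h fun _ _ => rfl).trans (Finset.sum_singleton _ _) using 1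
  have : fixCount τ (1 : Equiv.Perm (Fin n)) = τ ^ n := by
    simp [fixCount]
  rw [this, MonoidAlgebra.one_def, MonoidAlgebra.smul_single]
  simp

/-- Each permutation `π` of the letters up to `j` is uniquely `σ (i j)` with `σ` fixing `j` and `i =
π⁻¹ j ≤ j`. The factor `τ` on the left compensates for letters not yet reached, which `fixCount`
already counts as fixed points. -/
lemma gramElement_succ (τ : ℕ) (j : Fin n) :
    (τ : ℂ) • gramElement n τ (j + 1) = gramElement n τ j * ((τ : ℂ) • 1 + jucysMurphy j) := by
  classical
  have hf : ∀ σ : Equiv.Perm (Fin n), σ j = j → ∀ i,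
      (τ : ℂ) * fixCount τ (σ * Equiv.swap i j) =
        fixCount τ σ * (if i = j then (τ : ℂ) else 1) := fun σ hσ i => by
    split_ifs with h
    · rw [h, Equiv.swap_self, mul_comm]
      rfl
    · rw [mul_one, ← mul_fixCount_mul_swap τ hσ h]
      push_cast
      ring
  have hfac : (τ : ℂ) • (1 : GroupAlg n) + jucysMurphy j = ∑ i ∈ Finset.Iic j,
      MonoidAlgebra.single (Equiv.swap i j) (if i = j then (τ : ℂ) else 1) := by
    have hI : Finset.Iic j = insert j (Finset.univ.filter fun i : Fin n => i < j) := by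
      ext i
      simp [le_iff_eq_or_lt]
    rw [hI, Finset.sum_insert (by simp), if_pos rfl, Equiv.swap_self, jucysMurphy]
    congr 1
    · rw [MonoidAlgebra.one_def, MonoidAlgebra.smul_single, smul_eq_mul, mul_one]
      rfl
    · exact Finset.sum_congr rfl fun i hi => by rw [if_neg (Finset.mem_filter.1 hi).2.ne]
  rw [hfac, gramElement, gramElement, Finset.smul_sum, Finset.sum_mul_sum, ← Finset.sum_product']
  symm
  refine Finset.sum_bij' (fun p _ => p.1 * Equiv.swap p.2 j)
    (fun π _ => (π * Equiv.swap (π⁻¹ j) j, π⁻¹ j)) ?_ ?_ ?_ ?_ ?_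
  · rintro ⟨σ, i⟩ hp
    simp only [Finset.mem_product, Finset.mem_filter, Finset.mem_univ, true_and,
      Finset.mem_Iic] at hp ⊢
    intro x hx
    have hxj : j < x := Fin.lt_def.2 (by omega)
    rw [Equiv.Perm.mul_apply, Equiv.swap_apply_of_ne_of_ne (hp.2.trans_lt hxj).ne' hxj.ne']
    exact hp.1 x hxj.le
  · intro π hπ
    simp only [Finset.mem_product, Finset.mem_filter, Finset.mem_univ, true_and,
      Finset.mem_Iic] at hπ ⊢
    have hle : π⁻¹ j ≤ j := by
      by_contra hcon
      have h := hπ (π⁻¹ j) (by rw [not_le, Fin.lt_def] at hcon; omega)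
      rw [show π (π⁻¹ j) = j from π.apply_symm_apply j] at h
      exact hcon h.symm.le
    refine ⟨fun x hx => ?_, hle⟩
    rcases (Fin.le_def.2 hx).eq_or_lt with rfl | hx
    · rw [Equiv.Perm.mul_apply, Equiv.swap_apply_right]
      exact π.apply_symm_apply _
    · rw [Equiv.Perm.mul_apply, Equiv.swap_apply_of_ne_of_ne (hle.trans_lt hx).ne' hx.ne']
      exact hπ x (Nat.succ_le_of_lt (Fin.lt_def.1 hx))
  · rintro ⟨σ, i⟩ hp
    simp only [Finset.mem_product, Finset.mem_filter, Finset.mem_univ, true_and,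
      Finset.mem_Iic] at hp
    have hσ : σ.symm j = j := by rw [Equiv.symm_apply_eq, hp.1 j le_rfl]
    simp [hσ, mul_assoc]
  · intro π _
    simp [mul_assoc]
  · rintro ⟨σ, i⟩ hp
    simp only [Finset.mem_product, Finset.mem_filter, Finset.mem_univ, true_and,
      Finset.mem_Iic] at hp
    rw [MonoidAlgebra.single_mul_single, MonoidAlgebra.smul_single, smul_eq_mul,
      hf σ (hp.1 j le_rfl)]

/-- The Gram element `∑ τ ^ #cycles(σ) σ` is the product of the elements `τ + m_k` (Jucys): it acts
on the joint eigenvectors which belong to `T` by the content product of the shape of `T`. -/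
lemma gramElement_mul {τ : ℕ} (hτ : 0 < τ) {y : GroupAlg n} {c : Fin n → ℂ}
    (hy : ∀ k, jucysMurphy k * y = c k • y) :
    gramElement n τ n * y = (∏ k, ((τ : ℂ) + c k)) • y := by
  have hτ0 : (τ : ℂ) ≠ 0 := Nat.cast_ne_zero.2 hτ.ne'
  -- The powers of `τ` avoid division in the induction; they cancel at `j = n`.
  have key : ∀ j ≤ n, (τ : ℂ) ^ j • (gramElement n τ j * y) =
      ((τ : ℂ) ^ n * ∏ k ∈ Finset.univ.filter (fun k : Fin n => (k : ℕ) < j), ((τ : ℂ) + c k)) • y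
      := fun j => by
    induction j with
    | zero =>
      intro _
      rw [gramElement_zero]
      simp
    | succ j ih =>
      intro hj
      have hs := gramElement_succ τ (⟨j, hj⟩ : Fin n)
      have hfil : Finset.univ.filter (fun k : Fin n => (k : ℕ) < j + 1) =
          insert ⟨j, hj⟩ (Finset.univ.filter fun k : Fin n => (k : ℕ) < j) := by
        ext k
        simp [Fin.ext_iff, le_iff_eq_or_lt]
      rw [pow_succ, mul_smul, ← smul_mul_assoc, hs, mul_assoc, add_mul, hy, smul_mul_assoc,
        one_mul, ← add_smul, mul_smul_comm, smul_comm, ih (by omega), hfil,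
        Finset.prod_insert (by simp), smul_smul]
      congr 1
      ring
  have h := key n le_rfl
  rw [mul_smul] at h
  have h' := smul_right_injective (GroupAlg n) (pow_ne_zero n hτ0) h
  simpa using h'

lemma contentProduct_eq (τ : ℕ) {μ : YoungDiagram} (T : StandardTableau n μ) :
    contentProduct τ μ = ∏ k, ((τ : ℂ) + content (T.box k)) := by
  rw [contentProduct]
  symm
  refine Finset.prod_bij (fun k _ => T.box k) (fun k _ => T.box_mem k)
    (fun k _ l _ h => T.box_injective h) (fun b hb => ⟨T.entry ⟨b, hb⟩, Finset.mem_univ _, ?_⟩)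
    fun _ _ => rfl
  exact T.box_entry hb

end Gram

/-! ### Diagonal elements, their symmetries, and the pseudo-inverse. -/

section Weingarten

variable {n : ℕ}

/-- The element which acts on the image of `e_T` by the scalar `f T`. -/
def diagonalElement (f : Tableau n → ℂ) : GroupAlg n := ∑ T, f T • youngIdempotent T.2

lemma diagonalElement_mul (f g : Tableau n → ℂ) :
    diagonalElement f * diagonalElement g = diagonalElement (f * g) := by
  classical
  rw [diagonalElement, diagonalElement, diagonalElement, Finset.sum_mul_sum]
  refine Finset.sum_congr rfl fun T _ => ?_
  rw [Finset.sum_eq_single T]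
  · rw [smul_mul_smul_comm, isYoungOrthogonal_youngIdempotent.mul_eq, if_pos rfl, Pi.mul_apply]
  · intro T' _ h
    rw [smul_mul_smul_comm, isYoungOrthogonal_youngIdempotent.mul_eq, if_neg h.symm, smul_zero]
  · simp

lemma gramElement_eq {τ : ℕ} (hτ : 0 < τ) :
    gramElement n τ n = diagonalElement fun T => contentProduct τ T.1.1 := by
  rw [← mul_one (gramElement n τ n), ← isYoungOrthogonal_youngIdempotent.sum_eq, Finset.mul_sum,
    diagonalElement]
  refine Finset.sum_congr rfl fun T _ => ?_
  rw [gramElement_mul hτ fun k => isYoungOrthogonal_youngIdempotent.jucysMurphy_mul k T,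
    contentProduct_eq τ T.2]

/-- The convention `0⁻¹ = 0` absorbs the restriction to `c_λ ≠ 0`. -/
lemma weingartenElement_eq (n τ : ℕ) :
    weingartenElement n τ = diagonalElement fun T => (contentProduct τ T.1.1)⁻¹ := by
  classical
  rw [weingartenElement, diagonalElement, Fintype.sum_sigma, Finset.sum_filter]
  refine Finset.sum_congr rfl fun μ _ => ?_
  rw [centralIdempotent, Finset.smul_sum]
  split_ifs with h
  · rfl
  · exact (Finset.sum_eq_zero fun T _ => by rw [not_not.1 h, inv_zero, zero_smul]).symm

lemma coeff_gramElement (τ : ℕ) (σ : Equiv.Perm (Fin n)) :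
    (gramElement n τ n).coeff σ = fixCount τ σ := by
  classical
  have h : gramElement n τ n = ∑ π : Equiv.Perm (Fin n),
      MonoidAlgebra.single π (fixCount τ π : ℂ) := by
    rw [gramElement]
    refine Finset.sum_congr (Finset.filter_true_of_mem fun π _ x hx => ?_) fun _ _ => rfl
    exact absurd x.2 (not_lt.2 hx)
  rw [h, MonoidAlgebra.coeff_sum, Finsupp.finsetSum_apply]
  simp [Finsupp.single_apply]

/-! ### Inversion and complex conjugation on the group algebra -/

/-- The anti-automorphism of the group algebra which inverts the permutations. -/
def inversion (n : ℕ) : GroupAlg n →ₐ[ℂ] (GroupAlg n)ᵐᵒᵖ :=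
  MonoidAlgebra.lift ℂ (GroupAlg n)ᵐᵒᵖ (Equiv.Perm (Fin n))
    { toFun := fun σ => MulOpposite.op (MonoidAlgebra.single σ⁻¹ 1)
      map_one' := by rw [inv_one, ← MonoidAlgebra.one_def, MulOpposite.op_one]
      map_mul' := fun σ π => by
        rw [mul_inv_rev, ← MulOpposite.op_mul, MonoidAlgebra.single_mul_single, mul_one] }

lemma inversion_single (σ : Equiv.Perm (Fin n)) (r : ℂ) :
    (inversion n (MonoidAlgebra.single σ r)).unop = MonoidAlgebra.single σ⁻¹ r := by
  simp [inversion]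

lemma coeff_inversion (x : GroupAlg n) (σ : Equiv.Perm (Fin n)) :
    (inversion n x).unop.coeff σ = x.coeff σ⁻¹ := by
  classical
  induction x using MonoidAlgebra.induction_linear with
  | zero => simp
  | add x y hx hy => simp_all
  | single π r => simp [inversion_single, Finsupp.single_apply, inv_eq_iff_eq_inv]

lemma inversion_jucysMurphy (k : Fin n) : (inversion n (jucysMurphy k)).unop = jucysMurphy k := by
  rw [jucysMurphy, map_sum, Finset.unop_sum]
  exact Finset.sum_congr rfl fun i _ => by rw [inversion_single, Equiv.swap_inv]

/-- Inversion reverses products and fixes every `m_k`, so the image family has the same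
characterization; uniqueness applies. -/
lemma inversion_youngIdempotent (T : Tableau n) :
    (inversion n (youngIdempotent T.2)).unop = youngIdempotent T.2 := by
  have h : IsYoungOrthogonal fun T : Tableau n => (inversion n (youngIdempotent T.2)).unop := by
    refine ⟨fun T T' => ?_, ?_, fun k T => ?_, fun k T => ?_⟩
    · rw [← MulOpposite.unop_mul, ← map_mul, isYoungOrthogonal_youngIdempotent.mul_eq]
      by_cases h : T = T'
      · subst h; simp
      · simp [h, Ne.symm h]
    · rw [← Finset.unop_sum, ← map_sum, isYoungOrthogonal_youngIdempotent.sum_eq, map_one,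
        MulOpposite.unop_one]
    · rw [← inversion_jucysMurphy k, ← MulOpposite.unop_mul, ← map_mul,
        isYoungOrthogonal_youngIdempotent.mul_jucysMurphy, map_smul, MulOpposite.unop_smul]
    · rw [← inversion_jucysMurphy k, ← MulOpposite.unop_mul, ← map_mul,
        isYoungOrthogonal_youngIdempotent.jucysMurphy_mul, map_smul, MulOpposite.unop_smul]
  exact congrFun (h.eq isYoungOrthogonal_youngIdempotent) T

/-- Complex conjugation of the coefficients. -/
def conjugation (n : ℕ) : GroupAlg n →+* GroupAlg n :=
  MonoidAlgebra.mapRingHom (Equiv.Perm (Fin n)) (starRingEnd ℂ)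

lemma coeff_conjugation (x : GroupAlg n) (σ : Equiv.Perm (Fin n)) :
    (conjugation n x).coeff σ = starRingEnd ℂ (x.coeff σ) := by
  simp [conjugation]

lemma conjugation_smul (c : ℂ) (x : GroupAlg n) :
    conjugation n (c • x) = starRingEnd ℂ c • conjugation n x := by
  ext σ
  simp [coeff_conjugation]

lemma conjugation_jucysMurphy (k : Fin n) : conjugation n (jucysMurphy k) = jucysMurphy k := by
  rw [jucysMurphy, map_sum]
  exact Finset.sum_congr rfl fun i _ => by simp [conjugation]

lemma conj_content (b : ℕ × ℕ) : starRingEnd ℂ (content b) = content b := by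
  simp [content]

/-- Uniqueness again, since the contents and the coefficients of `m_k` are real. -/
lemma conjugation_youngIdempotent (T : Tableau n) :
    conjugation n (youngIdempotent T.2) = youngIdempotent T.2 := by
  have h : IsYoungOrthogonal fun T : Tableau n => conjugation n (youngIdempotent T.2) := by
    refine ⟨fun T T' => ?_, ?_, fun k T => ?_, fun k T => ?_⟩
    · rw [← map_mul, isYoungOrthogonal_youngIdempotent.mul_eq]
      split_ifs <;> simp
    · rw [← map_sum, isYoungOrthogonal_youngIdempotent.sum_eq, map_one]
    · rw [← conjugation_jucysMurphy k, ← map_mul,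
        isYoungOrthogonal_youngIdempotent.jucysMurphy_mul, conjugation_smul, conj_content]
    · rw [← conjugation_jucysMurphy k, ← map_mul,
        isYoungOrthogonal_youngIdempotent.mul_jucysMurphy, conjugation_smul, conj_content]
  exact congrFun (h.eq isYoungOrthogonal_youngIdempotent) T

lemma coeff_diagonalElement_inv (f : Tableau n → ℂ) (σ : Equiv.Perm (Fin n)) :
    (diagonalElement f).coeff σ⁻¹ = (diagonalElement f).coeff σ := by
  rw [← coeff_inversion]
  congr 2
  rw [diagonalElement, map_sum, Finset.unop_sum]
  exact Finset.sum_congr rfl fun T _ => by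
    rw [map_smul, MulOpposite.unop_smul, inversion_youngIdempotent]

lemma conj_coeff_diagonalElement {f : Tableau n → ℂ} (hf : ∀ T, starRingEnd ℂ (f T) = f T)
    (σ : Equiv.Perm (Fin n)) :
    starRingEnd ℂ ((diagonalElement f).coeff σ) = (diagonalElement f).coeff σ := by
  rw [← coeff_conjugation]
  congr 2
  rw [diagonalElement, map_sum]
  exact Finset.sum_congr rfl fun T _ => by
    rw [conjugation_smul, hf, conjugation_youngIdempotent]

/-! ### Regular representations and the pseudo-inverse -/

lemma leftRegularMatrix_apply (x : GroupAlg n) (σ σ' : Equiv.Perm (Fin n)) :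
    leftRegularMatrix x σ σ' = x.coeff (σ * σ'⁻¹) := by
  rw [leftRegularMatrix, LinearMap.toMatrix_apply, MonoidAlgebra.basis_apply,
    LinearMap.mulLeft_apply]
  change (x * MonoidAlgebra.single σ' 1).coeff σ = _
  rw [MonoidAlgebra.coeff_mul_single_apply, mul_one]

lemma rightRegularMatrix_apply (x : GroupAlg n) (σ σ' : Equiv.Perm (Fin n)) :
    rightRegularMatrix x σ σ' = x.coeff (σ'⁻¹ * σ) := by
  rw [rightRegularMatrix, LinearMap.toMatrix_apply, MonoidAlgebra.basis_apply,
    LinearMap.mulRight_apply]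
  change (MonoidAlgebra.single σ' 1 * x).coeff σ = _
  rw [MonoidAlgebra.coeff_single_mul_apply, one_mul]

lemma leftRegularMatrix_mul (x y : GroupAlg n) :
    leftRegularMatrix x * leftRegularMatrix y = leftRegularMatrix (x * y) := by
  rw [leftRegularMatrix, leftRegularMatrix, leftRegularMatrix, LinearMap.mulLeft_mul,
    ← LinearMap.toMatrix_comp]

lemma rightRegularMatrix_mul (x y : GroupAlg n) :
    rightRegularMatrix x * rightRegularMatrix y = rightRegularMatrix (y * x) := by
  rw [rightRegularMatrix, rightRegularMatrix, rightRegularMatrix, LinearMap.mulRight_mul,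
    ← LinearMap.toMatrix_comp]

/-- The left matrix involves `σ σ'⁻¹` instead of `σ⁻¹ σ'`; the count is invariant under conjugation
and inversion. -/
lemma leftRegularMatrix_gramElement (n τ : ℕ) :
    leftRegularMatrix (gramElement n τ n) = gramMatrix n τ := by
  ext σ σ'
  rw [leftRegularMatrix_apply, coeff_gramElement, gramMatrix_apply, fixCount_mul_comm,
    ← fixCount_inv, mul_inv_rev, inv_inv]

lemma rightRegularMatrix_gramElement (n τ : ℕ) :
    rightRegularMatrix (gramElement n τ n) = gramMatrix n τ := by
  ext σ σ'
  rw [rightRegularMatrix_apply, coeff_gramElement, gramMatrix_apply, ← fixCount_inv, mul_inv_rev,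
    inv_inv]

lemma isHermitian_leftRegularMatrix {f : Tableau n → ℂ} (hf : ∀ T, starRingEnd ℂ (f T) = f T) :
    (leftRegularMatrix (diagonalElement f)).IsHermitian := by
  ext σ σ'
  rw [Matrix.conjTranspose_apply, leftRegularMatrix_apply, leftRegularMatrix_apply,
    ← starRingEnd_apply, conj_coeff_diagonalElement hf, ← coeff_diagonalElement_inv, mul_inv_rev,
    inv_inv]

lemma isHermitian_rightRegularMatrix {f : Tableau n → ℂ} (hf : ∀ T, starRingEnd ℂ (f T) = f T) :
    (rightRegularMatrix (diagonalElement f)).IsHermitian := by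
  ext σ σ'
  rw [Matrix.conjTranspose_apply, rightRegularMatrix_apply, rightRegularMatrix_apply,
    ← starRingEnd_apply, conj_coeff_diagonalElement hf, ← coeff_diagonalElement_inv, mul_inv_rev,
    inv_inv]

/-- Taking adjoints in `(GY)(GX) = GX` gives `GX = (GX)(GY) = GY`, and similarly `XG = YG`; then `X
= XGX = YGY = Y`. -/
lemma IsPseudoInverse.eq {ι : Type*} [Fintype ι] {G X Y : Matrix ι ι ℂ}
    (hX : IsPseudoInverse G X) (hY : IsPseudoInverse G Y) : X = Y := by
  have h1 : G * X = G * Y := by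
    have h : (G * Y) * (G * X) = G * X := by rw [← mul_assoc, hY.mul_mul_self]
    have h' := congrArg Matrix.conjTranspose h
    rw [Matrix.conjTranspose_mul, hX.isHermitian_mul.eq, hY.isHermitian_mul.eq, ← mul_assoc,
      hX.mul_mul_self] at h'
    exact h'.symm
  have h2 : X * G = Y * G := by
    have h : (X * G) * (Y * G) = X * G := by rw [mul_assoc, ← mul_assoc G, hY.mul_mul_self]
    have h' := congrArg Matrix.conjTranspose h
    rw [Matrix.conjTranspose_mul, hX.isHermitian_mul'.eq, hY.isHermitian_mul'.eq, mul_assoc,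
      ← mul_assoc G, hX.mul_mul_self] at h'
    exact h'.symm
  rw [← hX.self_mul_mul, mul_assoc, h1, ← mul_assoc, h2, hY.self_mul_mul]

lemma IsPseudoInverse.iff_eq {ι : Type*} [Fintype ι] {G W : Matrix ι ι ℂ}
    (hW : IsPseudoInverse G W) (X : Matrix ι ι ℂ) : IsPseudoInverse G X ↔ X = W :=
  ⟨fun hX => hX.eq hW, fun h => h ▸ hW⟩

lemma inv_mul_mul_inv_self (c : ℂ) : c⁻¹ * c * c⁻¹ = c⁻¹ := by
  simpa using mul_inv_mul_cancel c⁻¹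

lemma conj_mul_inv_self (c : ℂ) : starRingEnd ℂ (c * c⁻¹) = c * c⁻¹ := by
  by_cases hc : c = 0
  · simp [hc]
  · simp [mul_inv_cancel₀ hc]

lemma conj_inv_mul_self (c : ℂ) : starRingEnd ℂ (c⁻¹ * c) = c⁻¹ * c := by
  rw [mul_comm, conj_mul_inv_self]

/-- Both matrices come from diagonal elements, so the conditions reduce to `c c⁻¹ c = c`, `c⁻¹ c c⁻¹
= c⁻¹` and the reality of `c c⁻¹`, valid for `c = 0` too. -/
lemma isPseudoInverse_leftRegularMatrix {τ : ℕ} (hτ : 0 < τ) :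
    IsPseudoInverse (gramMatrix n τ) (leftRegularMatrix (weingartenElement n τ)) := by
  rw [← leftRegularMatrix_gramElement, gramElement_eq hτ, weingartenElement_eq]
  constructor
  · simp only [leftRegularMatrix_mul, diagonalElement_mul]
    congr 2
    exact funext fun T => mul_inv_mul_cancel _
  · simp only [leftRegularMatrix_mul, diagonalElement_mul]
    congr 2
    exact funext fun T => inv_mul_mul_inv_self _
  · rw [leftRegularMatrix_mul, diagonalElement_mul]
    exact isHermitian_leftRegularMatrix fun T => conj_mul_inv_self _
  · rw [leftRegularMatrix_mul, diagonalElement_mul]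
    exact isHermitian_leftRegularMatrix fun T => conj_inv_mul_self _

lemma isPseudoInverse_rightRegularMatrix {τ : ℕ} (hτ : 0 < τ) :
    IsPseudoInverse (gramMatrix n τ) (rightRegularMatrix (weingartenElement n τ)) := by
  rw [← rightRegularMatrix_gramElement, gramElement_eq hτ, weingartenElement_eq]
  constructor
  · simp only [rightRegularMatrix_mul, diagonalElement_mul, ← mul_assoc]
    congr 2
    exact funext fun T => mul_inv_mul_cancel _
  · simp only [rightRegularMatrix_mul, diagonalElement_mul, ← mul_assoc]
    congr 2
    exact funext fun T => inv_mul_mul_inv_self _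
  · rw [rightRegularMatrix_mul, diagonalElement_mul]
    exact isHermitian_rightRegularMatrix fun T => conj_inv_mul_self _
  · rw [rightRegularMatrix_mul, diagonalElement_mul]
    exact isHermitian_rightRegularMatrix fun T => conj_mul_inv_self _

lemma isSymm_leftRegularMatrix_weingartenElement (n τ : ℕ) :
    (leftRegularMatrix (weingartenElement n τ)).IsSymm := by
  rw [weingartenElement_eq]
  ext σ σ'
  rw [Matrix.transpose_apply, leftRegularMatrix_apply, leftRegularMatrix_apply,
    ← coeff_diagonalElement_inv, mul_inv_rev, inv_inv]

end Weingarten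

end UnitaryWeingarten

end

theorem mainTheorem5 (n τ : ℕ) (hn : 0 < n) (hτ : 0 < τ) :
    -- the idempotents `e_T` are the ones characterized by the Jucys-Murphy elements
    (∀ e : UnitaryWeingarten.Tableau n → UnitaryWeingarten.GroupAlg n,
      UnitaryWeingarten.IsYoungOrthogonal e ↔
        e = fun T => UnitaryWeingarten.youngIdempotent T.2) ∧
    -- the Gram matrix
    (∀ σ σ' : Equiv.Perm (Fin n), UnitaryWeingarten.gramMatrix n τ σ σ' =
      (τ : ℂ) ^ UnitaryWeingarten.numCycles (σ⁻¹ * σ')) ∧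
    -- its pseudo-inverse, the Weingarten matrix
    (∀ X : Matrix (Equiv.Perm (Fin n)) (Equiv.Perm (Fin n)) ℂ,
      UnitaryWeingarten.IsPseudoInverse (UnitaryWeingarten.gramMatrix n τ) X ↔
        X = UnitaryWeingarten.leftRegularMatrix (UnitaryWeingarten.weingartenElement n τ)) ∧
    (∀ X : Matrix (Equiv.Perm (Fin n)) (Equiv.Perm (Fin n)) ℂ,
      UnitaryWeingarten.IsPseudoInverse (UnitaryWeingarten.gramMatrix n τ) X ↔
        X = UnitaryWeingarten.rightRegularMatrix (UnitaryWeingarten.weingartenElement n τ)) ∧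
    -- it is symmetric
    (UnitaryWeingarten.leftRegularMatrix (UnitaryWeingarten.weingartenElement n τ)).IsSymm := by
  refine ⟨fun e => UnitaryWeingarten.isYoungOrthogonal_iff, fun σ σ' => ?_,
    (UnitaryWeingarten.isPseudoInverse_leftRegularMatrix hτ).iff_eq,
    (UnitaryWeingarten.isPseudoInverse_rightRegularMatrix hτ).iff_eq,
    UnitaryWeingarten.isSymm_leftRegularMatrix_weingartenElement n τ⟩
  rw [UnitaryWeingarten.gramMatrix_apply, UnitaryWeingarten.fixCount_eq_pow, Nat.cast_pow]
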